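/- **Theorem.** For $A\in\mathbb R^{d\times m}$ let $|A|$ be its Euclidean (Frobenius) norm, and for $b\in\mathbb R^d$ let $l_{A,b}(x)=Ax+b$. A *regular domain* in $\mathbb R^m$ is a nonempty bounded connected open set whose boundary is Lebesgue-null. A map $u:\Omega\to\mathbb R^d$ on a regular domain is *piecewise affine* if $\Omega=\bigcup_i\Omega_i\cup\mathcal N$ with at most countably many pairwise disjoint regular domains $\Omega_i\subset\Omega$ and a null set $\mathcal N$, such that $u$ agrees with an affine map on each $\Omega_i$. For $K,K'\subset\mathbb R^{d\times m}$, $1\le p<\infty$ and $C>0$, say that $(K,K')$ has property $R_p(C)$ if for all $A\in K$, $b\in\mathbb R^d$, $\varepsilon,\alpha\in(0,1)$, $s\in(1,\infty)$ and every regular domain $\Omega\subset\mathbb R^m$ there is a piecewise affine map $u\in W^{1,1}(\Omega;\mathbb R^d)\cap C^{\alpha}(\overline\Omega;\mathbb R^d)$ with $u=l_{A,b}$ on $\partial\Omega$, $$\int_{\{x\in\Omega:\ \nabla u(x)\notin K'\}}(1+|\nabla u|)^s\,dx<\varepsilon|\Omega|,$$ $$|\{x\in\Omega:\ |\nabla u(x)|>t\}|\le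 C\,(1+|A|^p)\,|\Omega|\,t^{-p}\quad\text{for all }t>0.$$ *$K$ can be reduced to $K'$ in weak $L^p$* if $(K,K')$ has property $R_p(M^p)$ for some $M\ge 1$. Let $K,K',K''\subset\mathbb R^{d\times m}$, $1\le p<\infty$, $1<q<\infty$, $p\ne q$, and $r=\min\{p,q\}$. If $K$ can be reduced to $K'$ in weak $L^p$ and $K'$ can be reduced to $K''$ in weak $L^q$, then $K$ can be reduced to $K''$ in weak $L^r$. More precisely, whenever $M',M''\ge1$ are such that $(K,K')$ has property $R_p((M')^p)$ and $(K',K'')$ has property $R_q((M'')^q)$, then $(K,K'')$ has property $$R_r\Bigl(4\bigl(1+\tfrac{q}{|q-p|}\bigr)(M'M'')^r\Bigr).$$ -/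

import Mathlib

open MeasureTheory Set
open scoped NNReal ENNReal ContDiff Matrix

noncomputable section

namespace WeakReduction

/-- Euclidean space `ℝⁿ`. -/
abbrev E (n : ℕ) : Type := EuclideanSpace ℝ (Fin n)

/-- Real `d × m` matrices. -/
abbrev Mat (d m : ℕ) : Type := Matrix (Fin d) (Fin m) ℝ

/-- The Euclidean (Frobenius) norm `|A|` of a matrix. -/
def matNorm {d m : ℕ} (A : Mat d m) : ℝ := √(∑ i, ∑ j, A i j ^ 2)

/-- The affine map `l_{A,b}(x) = A x + b`. -/
def affineMap {d m : ℕ} (A : Mat d m) (b : E d) (x : E m) : E d :=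
  WithLp.toLp 2 (A *ᵥ x.ofLp) + b

/-- Regular domain: open, bounded, connected (in particular nonempty), with Lebesgue-null
boundary. -/
structure IsRegularDomain {m : ℕ} (Ω : Set (E m)) : Prop where
  isOpen : IsOpen Ω
  isBounded : Bornology.IsBounded Ω
  isConnected : IsConnected Ω
  volume_frontier : volume (frontier Ω) = 0

/-- `u` is piecewise affine on `Ω`: up to a null set, `Ω` is a countable union of pairwise disjoint
regular domains on each of which `u` agrees with an affine map. -/
def IsPiecewiseAffine {d m : ℕ} (Ω : Set (E m)) (u : E m → E d) : Prop :=
  ∃ P : Set (Set (E m)), P.Countable ∧ P.PairwiseDisjoint id ∧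
    (∀ U ∈ P, IsRegularDomain U ∧ U ⊆ Ω ∧ ∃ (A : Mat d m) (b : E d), EqOn u (affineMap A b) U) ∧
    volume (Ω \ ⋃₀ P) = 0

/-- `u ∈ W^{1,1}(Ω; ℝᵈ)` with weak gradient `G`, where `G x i j` represents `∂ⱼ uᵢ (x)`: both are
integrable on `Ω` and integration by parts holds against all test functions in `C_c^∞(Ω)`. -/
structure IsW11WithGradient {d m : ℕ} (Ω : Set (E m)) (u : E m → E d) (G : E m → Mat d m) :
    Prop where
  integrableOn : IntegrableOn u Ω
  integrableOn_grad : ∀ i j, IntegrableOn (fun x => G x i j) Ω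
  integral_eq : ∀ (i : Fin d) (j : Fin m) (φ : E m → ℝ), ContDiff ℝ ∞ φ → HasCompactSupport φ →
    tsupport φ ⊆ Ω →
    ∫ x in Ω, u x i * fderiv ℝ φ x (EuclideanSpace.single j 1) = - ∫ x in Ω, G x i j * φ x

/-- The approximation property with coefficient `C` in the weak `L^p` bound: for all `A ∈ K`, `b`,
`ε, α ∈ (0,1)`, `s ∈ (1,∞)` and every regular domain `Ω` there is a piecewise affine
`u ∈ W^{1,1}(Ω) ∩ C^α(closure Ω)`, with weak gradient `G`, such that `u = l_{A,b}` on `∂Ω`,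
`∫_{x ∈ Ω, ∇u(x) ∉ K'} (1 + |∇u|)^s dx < ε |Ω|` and
`|{x ∈ Ω : |∇u(x)| > t}| ≤ C (1 + |A|^p) |Ω| t^{-p}` for all `t > 0`. -/
def ReductionBound {d m : ℕ} (K K' : Set (Mat d m)) (p C : ℝ) : Prop :=
  ∀ A ∈ K, ∀ (b : E d) (ε : ℝ) (α : ℝ≥0) (s : ℝ), 0 < ε → ε < 1 → 0 < α → α < 1 → 1 < s →
    ∀ Ω : Set (E m), IsRegularDomain Ω →
      ∃ (u : E m → E d) (G : E m → Mat d m),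
        IsPiecewiseAffine Ω u ∧
        IsW11WithGradient Ω u G ∧
        (∃ H : ℝ≥0, HolderOnWith H α u (closure Ω)) ∧
        EqOn u (affineMap A b) (frontier Ω) ∧
        ∫⁻ x in {x ∈ Ω | G x ∉ K'}, ENNReal.ofReal ((1 + matNorm (G x)) ^ s)
          < ENNReal.ofReal ε * volume Ω ∧
        ∀ t : ℝ, 0 < t →
          volume {x ∈ Ω | t < matNorm (G x)}
            ≤ ENNReal.ofReal (C * (1 + matNorm A ^ p) * t ^ (-p)) * volume Ω

/-- `K` can be reduced to `K'` in weak `L^p`: for some `M ≥ 1` the approximation property holds with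
coefficient `M ^ p`. -/
def CanBeReduced {d m : ℕ} (K K' : Set (Mat d m)) (p : ℝ) : Prop :=
  ∃ M : ℝ, 1 ≤ M ∧ ReductionBound K K' p (M ^ p)

end WeakReduction

end

/-! The construction is a two-stage replacement. The first reduction gives a map `u` on `Ω` whose
gradient lies in `K'` outside a small set. On each affine piece with gradient in `K'`, fill almost
all of the piece with small disjoint balls. On each ball, replace `u` by a rescaled copy of the
solution that the second reduction provides on the unit ball. Pieces with gradient outside `K'` are
left alone.

The new map is `u + ∑' k, W k`, where the patch `W k` is a solution minus its boundary affine map,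
extended by zero outside its ball. Rescaling keeps gradients and shrinks Hölder and sup norms
(`IsPatch.scale`), so all patches can obey the same bounds. Disjoint supports then make the sum
Hölder (`holderWith_of_disjoint_support`). It is weakly differentiable because a continuous
extension by zero creates no singular gradient (`integral_mul_fderiv_of_zero_extension`) and because
weak `L^q` with `q > 1` bounds the `L¹` norm of each patch gradient by a multiple of `1 + |A k|`
times the volume of the ball. The sum of these bounds is controlled by the integral of `1 + |∇u|`.

For the weak bound, the set where the new gradient exceeds `t` fills at most the fraction `min 1
(M''^q (1 + |A k|^q) t^(-q))` of the `k`-th ball. Summing over balls gives the integral of the same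
expression in `|∇u|`, which the weak `L^p` bound on `∇u` controls by the layer-cake formula
(`lintegral_min_one_le_of_weak`). This is where `p ≠ q` enters: the integrals of powers of `t`
converge with constant `q / |q - p|`, and the exponent that survives is `min p q`. The untouched
pieces are handled by Chebyshev's inequality from the error integral of the first stage. -/

namespace WeakReduction

open Filter Topology Convolution

/-! ### Extension by zero of weakly differentiable functions -/

section ZeroExtension

variable {V : Type*} [NormedAddCommGroup V] [NormedSpace ℝ V] [FiniteDimensional ℝ V]
  [MeasurableSpace V] [BorelSpace V] (μ : Measure V) [μ.IsAddHaarMeasure]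

theorem fderiv_convolution_apply {k f : V → ℝ} (hk : ContDiff ℝ ∞ k) (hkc : HasCompactSupport k)
    (hf : Continuous f) (x v : V) :
    fderiv ℝ (k ⋆[ContinuousLinearMap.lsmul ℝ ℝ, μ] f) x v =
      ∫ t, fderiv ℝ k (x - t) v * f t ∂μ := by
  have h1 : ContDiff ℝ 1 k := hk.of_le (by exact_mod_cast le_top)
  rw [(hkc.hasFDerivAt_convolution_left (ContinuousLinearMap.lsmul ℝ ℝ) (μ := μ) h1
    hf.locallyIntegrable x).fderiv, convolution_eq_swap]
  rw [ContinuousLinearMap.integral_apply]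
  · rfl
  · have hc : Continuous fun t =>
        (((ContinuousLinearMap.lsmul ℝ ℝ).precompL V) (fderiv ℝ k (x - t))) (f t) := by
      have := (h1.continuous_fderiv one_ne_zero)
      fun_prop
    refine hc.integrable_of_hasCompactSupport ?_
    have hs : HasCompactSupport fun t => fderiv ℝ k (x - t) :=
      (hkc.fderiv ℝ).comp_homeomorph (Homeomorph.subLeft x)
    refine hs.mono ?_
    intro t ht h0
    apply ht
    simp [h0]

/-- The derivative of an even kernel is odd, so Fubini moves the differentiated mollifier from one
factor to the other at the cost of a sign. -/
theorem integral_mul_fderiv_convolution {k a f : V → ℝ} (hk : ContDiff ℝ ∞ k)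
    (hkc : HasCompactSupport k) (hke : ∀ x, k (-x) = k x)
    (ha : Continuous a) (hac : HasCompactSupport a) (hf : Continuous f)
    (hfc : HasCompactSupport f) (v : V) :
    ∫ x, a x * fderiv ℝ (k ⋆[ContinuousLinearMap.lsmul ℝ ℝ, μ] f) x v ∂μ =
      - ∫ x, f x * fderiv ℝ (k ⋆[ContinuousLinearMap.lsmul ℝ ℝ, μ] a) x v ∂μ := by
  have h1 : ContDiff ℝ 1 k := hk.of_le (by exact_mod_cast le_top)
  have hodd : ∀ x, fderiv ℝ k (-x) v = - fderiv ℝ k x v := by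
    intro x
    have h : HasFDerivAt (fun y => k (-y)) ((fderiv ℝ k (-x)).comp (-ContinuousLinearMap.id ℝ V)) x :=
      ((h1.differentiable one_ne_zero) (-x)).hasFDerivAt.comp x (hasFDerivAt_id x).neg
    rw [funext hke] at h
    rw [h.fderiv]; simp
  simp_rw [fderiv_convolution_apply μ hk hkc hf, fderiv_convolution_apply μ hk hkc ha,
    ← integral_const_mul]
  rw [integral_integral_swap_of_hasCompactSupport (f := fun x t => a x * (fderiv ℝ k (x - t) v * f t)),
    ← integral_neg]
  · congr 1; ext t
    rw [← integral_neg]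
    congr 1; ext x
    rw [← neg_sub x t, hodd]; ring
  · have := h1.continuous_fderiv one_ne_zero
    fun_prop
  · refine HasCompactSupport.intro (hac.prod hfc) ?_
    rintro ⟨x, t⟩ hx
    simp only [mem_prod, not_and_or] at hx
    rcases hx with hx | hx
    · simp [image_eq_zero_of_notMem_tsupport hx]
    · simp [image_eq_zero_of_notMem_tsupport hx]

/-- A continuous cutoff vanishing on `[-δ, δ]` and equal to one off `(-2δ, 2δ)`. -/
noncomputable def cutoff (δ y : ℝ) : ℝ := max 0 (min 1 (|y| / δ - 1))

theorem continuous_cutoff (δ : ℝ) : Continuous (cutoff δ) := by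
  unfold cutoff; fun_prop

theorem cutoff_nonneg (δ y : ℝ) : 0 ≤ cutoff δ y := le_max_left _ _

theorem cutoff_le_one (δ y : ℝ) : cutoff δ y ≤ 1 := max_le zero_le_one (min_le_left _ _)

theorem abs_cutoff_le (δ y : ℝ) : |cutoff δ y| ≤ 1 := by
  rw [abs_of_nonneg (cutoff_nonneg δ y)]; exact cutoff_le_one δ y

theorem cutoff_eq_zero {δ y : ℝ} (hδ : 0 < δ) (hy : |y| ≤ δ) : cutoff δ y = 0 := by
  have : |y| / δ - 1 ≤ 0 := by rw [sub_nonpos, div_le_one hδ]; exact hy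
  exact max_eq_left ((min_le_right _ _).trans this)

theorem cutoff_eq_one {δ y : ℝ} (hδ : 0 < δ) (hy : 2 * δ ≤ |y|) : cutoff δ y = 1 := by
  have : 1 ≤ |y| / δ - 1 := by rw [le_sub_iff_add_le, le_div_iff₀ hδ]; linarith
  rw [cutoff, min_eq_left this]; simp

theorem tendsto_cutoff (y : ℝ) :
    Tendsto (fun δ => cutoff δ y) (𝓝[>] 0) (𝓝 (if y = 0 then 0 else 1)) := by
  by_cases hy : y = 0
  · refine tendsto_const_nhds.congr' ?_
    filter_upwards [self_mem_nhdsWithin] with δ hδ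
    rw [cutoff_eq_zero hδ (by simpa [hy] using (le_of_lt hδ : (0:ℝ) ≤ δ))]
    simp [hy]
  · refine tendsto_const_nhds.congr' ?_
    have : Ioo (0 : ℝ) (|y| / 2) ∈ 𝓝[>] (0 : ℝ) := Ioo_mem_nhdsGT (by positivity)
    filter_upwards [this] with δ hδ
    rw [cutoff_eq_one hδ.1 (by linarith [hδ.2])]
    simp [hy]

/-- The primitive of `cutoff δ` vanishing at zero. -/
noncomputable def cutoffPrimitive (δ y : ℝ) : ℝ := ∫ τ in (0 : ℝ)..y, cutoff δ τ

theorem hasDerivAt_cutoffPrimitive (δ y : ℝ) :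
    HasDerivAt (cutoffPrimitive δ) (cutoff δ y) y :=
  (continuous_cutoff δ).integral_hasStrictDerivAt 0 y |>.hasDerivAt

theorem continuous_cutoffPrimitive (δ : ℝ) : Continuous (cutoffPrimitive δ) :=
  continuous_iff_continuousAt.2 fun y => (hasDerivAt_cutoffPrimitive δ y).continuousAt

theorem abs_cutoffPrimitive_le (δ y : ℝ) : |cutoffPrimitive δ y| ≤ |y| := by
  have := intervalIntegral.norm_integral_le_of_norm_le_const (a := (0 : ℝ)) (b := y) (C := 1)
    (f := cutoff δ) (fun x _ => abs_cutoff_le δ x)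
  simpa [cutoffPrimitive] using this

theorem tendsto_cutoffPrimitive (y : ℝ) :
    Tendsto (fun δ => cutoffPrimitive δ y) (𝓝[>] 0) (𝓝 y) := by
  have h : y = ∫ τ in (0 : ℝ)..y, (if τ = 0 then (0 : ℝ) else 1) := by
    rw [intervalIntegral.integral_congr_ae (g := fun _ => (1 : ℝ))]
    · simp
    · have : ∀ᵐ x : ℝ, x ≠ 0 := by simp [ae_iff]
      filter_upwards [this] with x hx _
      simp [hx]
  conv_rhs => rw [h]
  refine intervalIntegral.tendsto_integral_filter_of_dominated_convergence (fun _ => 1) ?_ ?_ ?_ ?_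
  · exact Eventually.of_forall fun δ => (continuous_cutoff δ).aestronglyMeasurable
  · exact Eventually.of_forall fun δ => Eventually.of_forall fun x _ => abs_cutoff_le δ x
  · simp
  · exact Eventually.of_forall fun x _ => tendsto_cutoff x

variable {μ}

theorem norm_normed_convolution_le (ρ : ContDiffBump (0 : V)) {f : V → ℝ} (hf : Continuous f)
    {C : ℝ} (hC : ∀ x, ‖f x‖ ≤ C) (x : V) :
    ‖(ρ.normed μ ⋆[ContinuousLinearMap.lsmul ℝ ℝ, μ] f) x‖ ≤ C := by
  have h := dist_convolution_le (μ := μ) (f := ρ.normed μ) (x₀ := x) (z₀ := (0 : ℝ)) (g := f)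
    (R := ρ.rOut) (ε := C) ((norm_nonneg _).trans (hC x)) ρ.support_normed_eq.subset
    ρ.nonneg_normed ρ.integral_normed hf.aestronglyMeasurable
    (fun y _ => by rw [dist_zero_right]; exact hC y)
  rwa [dist_zero_right] at h

theorem continuous_normed_convolution (ρ : ContDiffBump (0 : V)) {f : V → ℝ} (hf : Continuous f) :
    Continuous (ρ.normed μ ⋆[ContinuousLinearMap.lsmul ℝ ℝ, μ] f) :=
  ((ρ.hasCompactSupport_normed (μ := μ)).contDiff_convolution_left
    (ContinuousLinearMap.lsmul ℝ ℝ) ρ.contDiff_normed hf.locallyIntegrable (n := 0)).continuous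

/-- Truncation near zero replaces boundary regularity. With `Z` the mollified `W`, the classical
chain rule and integration by parts give `-∫ cutoff δ Z * φ * ∂Z`. Moving the mollifier onto `cutoff
δ Z * φ` produces a smooth function supported in `U`, which is admissible in the weak equation. -/
theorem integral_cutoffPrimitive_convolution {U : Set V} {W g φ : V → ℝ} {v : V} {δ : ℝ}
    (hW : Continuous W) (hWc : HasCompactSupport W)
    (hweak : ∀ ψ : V → ℝ, ContDiff ℝ ∞ ψ → HasCompactSupport ψ → tsupport ψ ⊆ U →
      ∫ x, W x * fderiv ℝ ψ x v ∂μ = - ∫ x, g x * ψ x ∂μ)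
    (hφ : ContDiff ℝ ∞ φ) (hφc : HasCompactSupport φ) (hδ : 0 < δ) (ρ : ContDiffBump (0 : V))
    (hclose : ∀ x, |(ρ.normed μ ⋆[ContinuousLinearMap.lsmul ℝ ℝ, μ] W) x - W x| ≤ δ / 2)
    (hthick : Metric.cthickening ρ.rOut {x | δ / 2 ≤ |W x|} ⊆ U) :
    ∫ x, cutoffPrimitive δ ((ρ.normed μ ⋆[ContinuousLinearMap.lsmul ℝ ℝ, μ] W) x) *
        fderiv ℝ φ x v ∂μ =
      - ∫ x, g x * (ρ.normed μ ⋆[ContinuousLinearMap.lsmul ℝ ℝ, μ] fun y =>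
        cutoff δ ((ρ.normed μ ⋆[ContinuousLinearMap.lsmul ℝ ℝ, μ] W) y) * φ y) x ∂μ := by
  set Z := ρ.normed μ ⋆[ContinuousLinearMap.lsmul ℝ ℝ, μ] W with hZ
  set a : V → ℝ := fun y => cutoff δ (Z y) * φ y with ha
  have hk : ContDiff ℝ ∞ (ρ.normed μ) := ρ.contDiff_normed
  have hkc : HasCompactSupport (ρ.normed μ) := ρ.hasCompactSupport_normed
  have hZs : ContDiff ℝ ∞ Z := hkc.contDiff_convolution_left _ hk hW.locallyIntegrable
  have hZ1 : ContDiff ℝ 1 Z := hZs.of_le (by exact_mod_cast le_top)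
  have hφ1 : ContDiff ℝ 1 φ := hφ.of_le (by exact_mod_cast le_top)
  have hZd : Differentiable ℝ Z := hZ1.differentiable one_ne_zero
  have hφd : Differentiable ℝ φ := hφ1.differentiable one_ne_zero
  have hdZ : Continuous (fderiv ℝ Z) := hZ1.continuous_fderiv one_ne_zero
  have hdφ : Continuous (fderiv ℝ φ) := hφ1.continuous_fderiv one_ne_zero
  have hac : Continuous a := ((continuous_cutoff δ).comp hZ1.continuous).mul hφ.continuous
  have has : HasCompactSupport a := hφc.mul_left
  have hT : ∀ x, HasFDerivAt (fun x => cutoffPrimitive δ (Z x)) (cutoff δ (Z x) • fderiv ℝ Z x) x :=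
    fun x => (hasDerivAt_cutoffPrimitive δ (Z x)).comp_hasFDerivAt x (hZd x).hasFDerivAt
  have hTc : Continuous fun x => cutoffPrimitive δ (Z x) :=
    (continuous_cutoffPrimitive δ).comp hZ1.continuous
  have hdφs : HasCompactSupport fun x => fderiv ℝ φ x v := by
    refine (hφc.fderiv ℝ).mono fun x hx h0 => hx ?_
    simp [h0]
  have e1 : ∫ x, cutoffPrimitive δ (Z x) * fderiv ℝ φ x v ∂μ = - ∫ x, a x * fderiv ℝ Z x v ∂μ := by
    rw [integral_mul_fderiv_eq_neg_fderiv_mul_of_integrable]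
    · congr 2; ext x
      rw [(hT x).fderiv]; simp [ha]; ring
    · have : (fun x => fderiv ℝ (fun x => cutoffPrimitive δ (Z x)) x v * φ x) =
          fun x => a x * fderiv ℝ Z x v := by
        ext x; rw [(hT x).fderiv]; simp [ha]; ring
      rw [this]
      exact (hac.mul (hdZ.clm_apply continuous_const)).integrable_of_hasCompactSupport has.mul_right
    · exact (hTc.mul (hdφ.clm_apply continuous_const)).integrable_of_hasCompactSupport hdφs.mul_left
    · exact (hTc.mul hφ.continuous).integrable_of_hasCompactSupport hφc.mul_left
    · exact fun x _ => (hT x).differentiableAt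
    · exact fun x _ => hφd x
  rw [e1, integral_mul_fderiv_convolution μ hk hkc (fun x => ρ.normed_neg x) hac has hW hWc,
    neg_neg]
  -- Where `a` is nonzero, `|Z| > δ` and hence `|W| ≥ δ / 2`; mollifying enlarges this set by at
  -- most `ρ.rOut`.
  refine hweak _ (hkc.contDiff_convolution_left _ hk hac.locallyIntegrable)
    (hkc.convolution _ has) (Subset.trans ?_ hthick)
  refine closure_minimal ?_ Metric.isClosed_cthickening
  refine (support_convolution_subset _).trans ?_
  rintro _ ⟨y, hy, z, hz, rfl⟩
  rw [ρ.support_normed_eq] at hy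
  have hzW : δ / 2 ≤ |W z| := by
    have h1 : δ < |Z z| := by
      by_contra h
      exact hz (by simp [ha, cutoff_eq_zero hδ (not_lt.1 h)])
    have h2 := hclose z
    have h3 := abs_sub_abs_le_abs_sub (Z z) (W z)
    linarith
  refine Metric.mem_cthickening_of_dist_le _ z _ _ hzW ?_
  simpa [dist_eq_norm] using (mem_ball_zero_iff.1 hy).le

/-- The mollification radius tends to zero at fixed `δ`. The set `{δ / 2 ≤ |W|}` is compact and
inside `U`, so a whole thickening of it stays in `U`. -/
theorem integral_cutoffPrimitive_mul_fderiv {U : Set V} (hU : IsOpen U) {W g φ : V → ℝ} {v : V}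
    {δ : ℝ} (hW : Continuous W) (hWc : HasCompactSupport W) (hW0 : ∀ x ∉ U, W x = 0)
    (hg : Integrable g μ)
    (hweak : ∀ ψ : V → ℝ, ContDiff ℝ ∞ ψ → HasCompactSupport ψ → tsupport ψ ⊆ U →
      ∫ x, W x * fderiv ℝ ψ x v ∂μ = - ∫ x, g x * ψ x ∂μ)
    (hφ : ContDiff ℝ ∞ φ) (hφc : HasCompactSupport φ) (hδ : 0 < δ) :
    ∫ x, cutoffPrimitive δ (W x) * fderiv ℝ φ x v ∂μ =
      - ∫ x, g x * (cutoff δ (W x) * φ x) ∂μ := by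
  have hr : ∀ n : ℕ, (0 : ℝ) < 1 / ((n : ℝ) + 1) := fun n => by positivity
  let ρ : ℕ → ContDiffBump (0 : V) := fun n =>
    ⟨1 / ((n : ℝ) + 1) / 2, 1 / ((n : ℝ) + 1), half_pos (hr n), half_lt_self (hr n)⟩
  have hρ : Tendsto (fun n => (ρ n).rOut) atTop (𝓝 0) := tendsto_one_div_add_atTop_nhds_zero_nat
  set Z : ℕ → V → ℝ := fun n => (ρ n).normed μ ⋆[ContinuousLinearMap.lsmul ℝ ℝ, μ] W with hZ
  have hunif : ∀ η > 0, ∀ᶠ n in atTop, ∀ x, |Z n x - W x| ≤ η := by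
    intro η hη
    have huc := hW.uniformContinuous_of_tendsto_cocompact hWc.is_zero_at_infty
    obtain ⟨r, hr0, hr⟩ := Metric.uniformContinuous_iff.1 huc η hη
    filter_upwards [hρ.eventually (gt_mem_nhds hr0)] with n hn x
    exact ContDiffBump.dist_normed_convolution_le hW.aestronglyMeasurable fun y hy =>
      (hr ((Metric.mem_ball.1 hy).trans hn)).le
  have hWδ : IsCompact {x | δ / 2 ≤ |W x|} := by
    refine hWc.of_isClosed_subset (isClosed_le continuous_const hW.abs) fun x hx => ?_
    refine subset_tsupport _ fun h0 => ?_
    simp only [mem_ofPred_eq, h0, abs_zero] at hx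
    linarith
  have hWU : {x | δ / 2 ≤ |W x|} ⊆ U := by
    intro x hx
    by_contra h
    simp only [mem_ofPred_eq, hW0 x h, abs_zero] at hx
    linarith
  obtain ⟨r, hr0, hrU⟩ := hWδ.exists_cthickening_subset_open hU hWU
  have heq : ∀ᶠ n in atTop, ∫ x, cutoffPrimitive δ (Z n x) * fderiv ℝ φ x v ∂μ =
      - ∫ x, g x * ((ρ n).normed μ ⋆[ContinuousLinearMap.lsmul ℝ ℝ, μ] fun y =>
        cutoff δ (Z n y) * φ y) x ∂μ := by
    filter_upwards [hunif (δ / 2) (by positivity), hρ.eventually (gt_mem_nhds hr0)] with n h1 h2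
    exact integral_cutoffPrimitive_convolution hW hWc hweak hφ hφc hδ (ρ n) h1
      ((Metric.cthickening_mono h2.le _).trans hrU)
  have hφ1 : ContDiff ℝ 1 φ := hφ.of_le (by exact_mod_cast le_top)
  have hdφ : Continuous fun x => fderiv ℝ φ x v :=
    (hφ1.continuous_fderiv one_ne_zero).clm_apply continuous_const
  have hdφs : HasCompactSupport fun x => fderiv ℝ φ x v := by
    refine (hφc.fderiv ℝ).mono fun x hx h0 => hx ?_
    simp [h0]
  have hZc : ∀ n, Continuous (Z n) := fun n =>
    continuous_normed_convolution (ρ n) hW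
  -- The function being mollified in `lim2` itself depends on `n`, so convergence is needed jointly
  -- in the index and the point.
  have hZt : ∀ x, Tendsto (fun y : ℕ × V => Z y.1 y.2) (atTop ×ˢ 𝓝 x) (𝓝 (W x)) := by
    intro x
    have h1 : Tendsto (fun y : ℕ × V => W y.2) (atTop ×ˢ 𝓝 x) (𝓝 (W x)) :=
      (hW.tendsto x).comp tendsto_snd
    have h2 : Tendsto (fun y : ℕ × V => Z y.1 y.2 - W y.2) (atTop ×ˢ 𝓝 x) (𝓝 0) := by
      rw [Metric.tendsto_nhds]
      intro η hη
      filter_upwards [(hunif (η / 2) (by positivity)).prod_inl (𝓝 x)] with y hy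
      have := hy y.2
      rw [Real.dist_eq, sub_zero]
      linarith
    simpa using h2.add h1
  obtain ⟨CW, hCW⟩ := hWc.exists_bound_of_continuous hW
  obtain ⟨Cφ, hCφ⟩ := hφc.exists_bound_of_continuous hφ.continuous
  have lim1 : Tendsto (fun n => ∫ x, cutoffPrimitive δ (Z n x) * fderiv ℝ φ x v ∂μ) atTop
      (𝓝 (∫ x, cutoffPrimitive δ (W x) * fderiv ℝ φ x v ∂μ)) := by
    refine tendsto_integral_filter_of_dominated_convergence
      (fun x => (CW + 1) * ‖fderiv ℝ φ x v‖) ?_ ?_ ?_ ?_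
    · exact Eventually.of_forall fun n =>
        (((continuous_cutoffPrimitive δ).comp (hZc n)).mul hdφ).aestronglyMeasurable
    · filter_upwards [hunif 1 one_pos] with n hn
      refine Eventually.of_forall fun x => ?_
      rw [norm_mul]
      gcongr
      have h1 := abs_cutoffPrimitive_le δ (Z n x)
      have h2 := hn x
      have h3 := hCW x
      have h4 := abs_sub_abs_le_abs_sub (Z n x) (W x)
      rw [Real.norm_eq_abs] at h3 ⊢
      linarith
    · exact ((hdφ.integrable_of_hasCompactSupport hdφs).norm).const_mul _
    · refine Eventually.of_forall fun x => Tendsto.mul_const _ ?_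
      have hx : Tendsto (fun n => Z n x) atTop (𝓝 (W x)) := by
        rw [Metric.tendsto_nhds]
        intro η hη
        filter_upwards [hunif (η / 2) (by positivity)] with n hn
        rw [Real.dist_eq]
        linarith [hn x]
      exact ((continuous_cutoffPrimitive δ).tendsto (W x)).comp hx
  have lim2 : Tendsto (fun n => - ∫ x, g x * ((ρ n).normed μ ⋆[ContinuousLinearMap.lsmul ℝ ℝ, μ]
      fun y => cutoff δ (Z n y) * φ y) x ∂μ) atTop
      (𝓝 (- ∫ x, g x * (cutoff δ (W x) * φ x) ∂μ)) := by
    refine Tendsto.neg ?_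
    have hac : ∀ n, Continuous fun y => cutoff δ (Z n y) * φ y := fun n =>
      ((continuous_cutoff δ).comp (hZc n)).mul hφ.continuous
    have hab : ∀ n y, ‖cutoff δ (Z n y) * φ y‖ ≤ Cφ := fun n y => by
      rw [norm_mul]
      calc _ ≤ 1 * ‖φ y‖ := by gcongr; exact abs_cutoff_le _ _
        _ ≤ Cφ := by simpa using hCφ y
    refine tendsto_integral_filter_of_dominated_convergence
      (fun x => ‖g x‖ * Cφ) ?_ ?_ ?_ ?_
    · refine Eventually.of_forall fun n => hg.aestronglyMeasurable.mul ?_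
      exact (continuous_normed_convolution (ρ n) (hac n)).aestronglyMeasurable
    · refine Eventually.of_forall fun n => Eventually.of_forall fun x => ?_
      rw [norm_mul]
      gcongr
      exact norm_normed_convolution_le (ρ n) (hac n) (hab n) x
    · exact hg.norm.mul_const _
    · refine Eventually.of_forall fun x => Tendsto.const_mul _ ?_
      refine ContDiffBump.convolution_tendsto_right (x₀ := x) hρ
        (Eventually.of_forall fun n => (hac n).aestronglyMeasurable) ?_ tendsto_const_nhds
      refine Tendsto.mul ?_ ((hφ.continuous.tendsto x).comp tendsto_snd)
      exact ((continuous_cutoff δ).tendsto _).comp (hZt x)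
  exact tendsto_nhds_unique (lim1.congr' heq) lim2

/-- A weakly differentiable function on an open set that extends continuously by zero has, as its
extension, the extension by zero of its weak derivative. -/
theorem integral_mul_fderiv_of_zero_extension {U : Set V} (hU : IsOpen U) {W g φ : V → ℝ} {v : V}
    (hW : Continuous W) (hWc : HasCompactSupport W) (hW0 : ∀ x ∉ U, W x = 0)
    (hg : Integrable g μ) (hg0 : ∀ x ∉ U, g x = 0)
    (hweak : ∀ ψ : V → ℝ, ContDiff ℝ ∞ ψ → HasCompactSupport ψ → tsupport ψ ⊆ U →
      ∫ x, W x * fderiv ℝ ψ x v ∂μ = - ∫ x, g x * ψ x ∂μ)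
    (hφ : ContDiff ℝ ∞ φ) (hφc : HasCompactSupport φ) :
    ∫ x, W x * fderiv ℝ φ x v ∂μ = - ∫ x, g x * φ x ∂μ := by
  -- Letting `δ → 0` recovers `W` on the left, but on the right only the part of `g` living on `{W ≠
  -- 0}`.
  have key : ∀ φ : V → ℝ, ContDiff ℝ ∞ φ → HasCompactSupport φ →
      ∫ x, W x * fderiv ℝ φ x v ∂μ = - ∫ x, g x * ((if W x = 0 then 0 else 1) * φ x) ∂μ := by
    intro φ hφ hφc
    have hφ1 : ContDiff ℝ 1 φ := hφ.of_le (by exact_mod_cast le_top)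
    have hdφ : Continuous fun x => fderiv ℝ φ x v :=
      (hφ1.continuous_fderiv one_ne_zero).clm_apply continuous_const
    obtain ⟨Cφ, hCφ⟩ := hφc.exists_bound_of_continuous hφ.continuous
    have lim1 : Tendsto (fun δ => ∫ x, cutoffPrimitive δ (W x) * fderiv ℝ φ x v ∂μ) (𝓝[>] 0)
        (𝓝 (∫ x, W x * fderiv ℝ φ x v ∂μ)) := by
      refine tendsto_integral_filter_of_dominated_convergence
        (fun x => ‖W x * fderiv ℝ φ x v‖) ?_ ?_ ?_ ?_
      · exact Eventually.of_forall fun δ =>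
          (((continuous_cutoffPrimitive δ).comp hW).mul hdφ).aestronglyMeasurable
      · refine Eventually.of_forall fun δ => Eventually.of_forall fun x => ?_
        rw [norm_mul, norm_mul]
        gcongr
        exact abs_cutoffPrimitive_le δ _
      · exact ((hW.mul hdφ).integrable_of_hasCompactSupport hWc.mul_right).norm
      · exact Eventually.of_forall fun x => (tendsto_cutoffPrimitive (W x)).mul_const _
    have lim2 : Tendsto (fun δ => - ∫ x, g x * (cutoff δ (W x) * φ x) ∂μ) (𝓝[>] 0)
        (𝓝 (- ∫ x, g x * ((if W x = 0 then 0 else 1) * φ x) ∂μ)) := by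
      refine Tendsto.neg ?_
      refine tendsto_integral_filter_of_dominated_convergence
        (fun x => ‖g x‖ * Cφ) ?_ ?_ ?_ ?_
      · exact Eventually.of_forall fun δ => hg.aestronglyMeasurable.mul
          (((continuous_cutoff δ).comp hW).mul hφ.continuous).aestronglyMeasurable
      · refine Eventually.of_forall fun δ => Eventually.of_forall fun x => ?_
        rw [norm_mul, norm_mul]
        gcongr
        calc _ ≤ 1 * ‖φ x‖ := by gcongr; exact abs_cutoff_le _ _
          _ ≤ Cφ := by simpa using hCφ x
      · exact hg.norm.mul_const _
      · exact Eventually.of_forall fun x => ((tendsto_cutoff (W x)).mul_const _).const_mul _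
    refine tendsto_nhds_unique (lim1.congr' ?_) lim2
    filter_upwards [self_mem_nhdsWithin] with δ hδ
    exact integral_cutoffPrimitive_mul_fderiv hU hW hWc hW0 hg hweak hφ hφc hδ
  have hms : MeasurableSet {x | W x = 0} := (isClosed_singleton.preimage hW).measurableSet
  have hind : ∀ x, {x | W x = 0}.indicator g x = g x - g x * (if W x = 0 then 0 else 1) := by
    intro x
    by_cases h : W x = 0 <;> simp [h]
  have hgi : Integrable ({x | W x = 0}.indicator g) μ := hg.indicator hms
  have hgi' : Integrable (fun x => g x * (if W x = 0 then (0 : ℝ) else 1)) μ := by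
    refine (hg.sub hgi).congr (Eventually.of_forall fun x => ?_)
    simp [hind x]
  -- For test functions supported in `U`, both `key` and `hweak` hold. Their difference shows that
  -- nothing was lost: the weak derivative vanishes a.e. on the zero set of `W` in `U`.
  have hzero : ∀ᵐ x ∂μ, x ∈ U → {x | W x = 0}.indicator g x = 0 := by
    refine hU.ae_eq_zero_of_integral_contDiff_smul_eq_zero (hgi.locallyIntegrable.locallyIntegrableOn U)
      fun ψ hψ hψc hψU => ?_
    obtain ⟨C, hC⟩ := hψc.exists_bound_of_continuous hψ.continuous
    have hb : ∀ f : V → ℝ, Integrable f μ → Integrable (fun x => f x * ψ x) μ := fun f hf =>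
      hf.mul_bdd (c := C) hψ.continuous.aestronglyMeasurable (Eventually.of_forall hC)
    have h1 := hweak ψ hψ hψc hψU
    rw [key ψ hψ hψc, neg_inj] at h1
    have h2 : ∀ x, ψ x • {x | W x = 0}.indicator g x =
        g x * ψ x - g x * (if W x = 0 then 0 else 1) * ψ x := by
      intro x; rw [hind, smul_eq_mul]; ring
    simp_rw [h2]
    rw [integral_sub (hb _ hg) (hb _ hgi'), ← h1, sub_eq_zero]
    simp_rw [mul_assoc]
  rw [key φ hφ hφc]
  congr 1
  refine integral_congr_ae ?_
  filter_upwards [hzero] with x hx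
  have : {x | W x = 0}.indicator g x = 0 := by
    by_cases h : x ∈ U
    · exact hx h
    · simp [indicator, hg0 x h]
  rw [hind, sub_eq_zero] at this
  rw [← mul_assoc, ← this]

end ZeroExtension

end WeakReduction

namespace WeakReduction

open Filter Topology

variable {d m : ℕ}

/-! ### The Frobenius norm and affine maps -/

section MatNorm

theorem matNorm_nonneg (A : Mat d m) : 0 ≤ matNorm A := Real.sqrt_nonneg _

theorem abs_apply_le_matNorm (A : Mat d m) (i : Fin d) (j : Fin m) : |A i j| ≤ matNorm A := by
  refine Real.abs_le_sqrt ?_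
  calc A i j ^ 2 ≤ ∑ j, A i j ^ 2 :=
        Finset.single_le_sum (f := fun j => A i j ^ 2) (fun _ _ => sq_nonneg _) (Finset.mem_univ j)
    _ ≤ _ := Finset.single_le_sum (f := fun i => ∑ j, A i j ^ 2)
        (fun _ _ => Finset.sum_nonneg fun _ _ => sq_nonneg _) (Finset.mem_univ i)

theorem matNorm_le_sum_abs (A : Mat d m) : matNorm A ≤ ∑ i, ∑ j, |A i j| := by
  rw [matNorm]
  refine Real.sqrt_le_iff.2 ⟨by positivity, ?_⟩
  have h := Finset.sum_sq_le_sq_sum_of_nonneg (s := (Finset.univ : Finset (Fin d × Fin m)))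
    (f := fun p => |A p.1 p.2|) (fun _ _ => abs_nonneg _)
  simpa [Fintype.sum_prod_type] using h

theorem aemeasurable_matNorm {μ : Measure (E m)} {G : E m → Mat d m}
    (hG : ∀ i j, AEMeasurable (fun x => G x i j) μ) : AEMeasurable (fun x => matNorm (G x)) μ := by
  unfold matNorm
  fun_prop

theorem integrable_matNorm {μ : Measure (E m)} {G : E m → Mat d m}
    (hG : ∀ i j, Integrable (fun x => G x i j) μ) : Integrable (fun x => matNorm (G x)) μ := by
  have hs : Integrable (fun x => ∑ i, ∑ j, |G x i j|) μ :=
    integrable_finsetSum _ fun i _ => integrable_finsetSum _ fun j _ => (hG i j).abs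
  refine hs.mono' (aemeasurable_matNorm fun i j => (hG i j).aemeasurable).aestronglyMeasurable ?_
  refine Eventually.of_forall fun x => ?_
  rw [Real.norm_of_nonneg (matNorm_nonneg _)]
  exact matNorm_le_sum_abs _

end MatNorm

section Affine

theorem affineMap_apply (A : Mat d m) (b : E d) (x : E m) (i : Fin d) :
    affineMap A b x i = ∑ j, A i j * x j + b i := by
  simp [affineMap, Matrix.mulVec, dotProduct]

theorem continuous_affineMap (A : Mat d m) (b : E d) : Continuous (affineMap A b) := by
  unfold affineMap
  refine Continuous.add ?_ continuous_const
  refine (PiLp.continuous_toLp 2 _).comp ?_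
  exact Continuous.matrix_mulVec continuous_const (PiLp.continuous_ofLp 2 _)

theorem affineMap_sub_affineMap (A A' : Mat d m) (b b' : E d) (x : E m) :
    affineMap A b x - affineMap A' b' x = affineMap (A - A') (b - b') x := by
  ext i
  simp only [PiLp.sub_apply, affineMap_apply, Matrix.sub_apply, sub_mul, Finset.sum_sub_distrib]
  ring

theorem affineMap_add_affineMap (A A' : Mat d m) (b b' : E d) (x : E m) :
    affineMap A b x + affineMap A' b' x = affineMap (A + A') (b + b') x := by
  ext i
  simp only [PiLp.add_apply, affineMap_apply, Matrix.add_apply, add_mul, Finset.sum_add_distrib]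
  ring

theorem smul_affineMap_smul_sub (A : Mat d m) (b : E d) {r : ℝ} (hr : r ≠ 0) (c x : E m) :
    r • affineMap A b (r⁻¹ • (x - c)) = affineMap A (r • b - affineMap A 0 c) x := by
  ext i
  simp only [PiLp.smul_apply, PiLp.sub_apply, affineMap_apply, smul_eq_mul, mul_add, Finset.mul_sum,
    PiLp.zero_apply, add_zero, mul_sub, Finset.sum_sub_distrib]
  have h : ∀ a y : ℝ, r * (a * (r⁻¹ * y)) = a * y := fun a y => by field_simp
  simp only [h]
  ring

theorem hasFDerivAt_affineMap_apply (A : Mat d m) (b : E d) (i : Fin d) (x : E m) :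
    HasFDerivAt (fun x => affineMap A b x i)
      (∑ j, A i j • (EuclideanSpace.proj j : E m →L[ℝ] ℝ)) x := by
  simp_rw [affineMap_apply]
  refine HasFDerivAt.add_const _ ?_
  refine HasFDerivAt.fun_sum fun j _ => ?_
  exact ((EuclideanSpace.proj j : E m →L[ℝ] ℝ).hasFDerivAt (x := x)).const_mul (A i j)

theorem fderiv_affineMap_apply (A : Mat d m) (b : E d) (i : Fin d) (j : Fin m) (x : E m) :
    fderiv ℝ (fun x => affineMap A b x i) x (EuclideanSpace.single j 1) = A i j := by
  rw [(hasFDerivAt_affineMap_apply A b i x).fderiv]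
  simp

end Affine

/-! ### Weak gradients: algebra, uniqueness, extension and rescaling -/

section TestFunctions

theorem fderiv_eq_zero_of_notMem_tsupport {φ : E m → ℝ} {x : E m} (hx : x ∉ tsupport φ) :
    fderiv ℝ φ x = 0 := by
  by_contra h
  exact hx (support_fderiv_subset ℝ h)

theorem setIntegral_mul_testFunction {S : Set (E m)} {φ : E m → ℝ} (h : tsupport φ ⊆ S)
    (f : E m → ℝ) : ∫ x in S, f x * φ x = ∫ x, f x * φ x :=
  setIntegral_eq_integral_of_forall_compl_eq_zero fun x hx => by
    rw [image_eq_zero_of_notMem_tsupport fun h' => hx (h h'), mul_zero]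

theorem setIntegral_mul_fderiv_testFunction {S : Set (E m)} {φ : E m → ℝ} (h : tsupport φ ⊆ S)
    (f : E m → ℝ) (v : E m) : ∫ x in S, f x * fderiv ℝ φ x v = ∫ x, f x * fderiv ℝ φ x v :=
  setIntegral_eq_integral_of_forall_compl_eq_zero fun x hx => by
    rw [fderiv_eq_zero_of_notMem_tsupport fun h' => hx (h h')]; simp

theorem _root_.MeasureTheory.Integrable.mul_testFunction {μ : Measure (E m)} {f φ : E m → ℝ}
    (hf : Integrable f μ) (hφ : Continuous φ) (hφc : HasCompactSupport φ) :
    Integrable (fun x => f x * φ x) μ := by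
  obtain ⟨C, hC⟩ := hφc.exists_bound_of_continuous hφ
  exact hf.mul_bdd (c := C) hφ.aestronglyMeasurable (Eventually.of_forall hC)

theorem continuous_fderiv_testFunction {φ : E m → ℝ} (hφ : ContDiff ℝ ∞ φ) (v : E m) :
    Continuous fun x => fderiv ℝ φ x v :=
  (hφ.continuous_fderiv (by simp)).clm_apply continuous_const

end TestFunctions

namespace IsW11WithGradient

variable {Ω : Set (E m)} {u u' : E m → E d} {G G' : E m → Mat d m}

theorem integrableOn_apply (h : IsW11WithGradient Ω u G) (i : Fin d) :
    IntegrableOn (fun x => u x i) Ω := Integrable.eval_piLp h.integrableOn i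

theorem mono (h : IsW11WithGradient Ω u G) {U : Set (E m)} (hU : U ⊆ Ω) :
    IsW11WithGradient U u G where
  integrableOn := h.integrableOn.mono_set hU
  integrableOn_grad i j := (h.integrableOn_grad i j).mono_set hU
  integral_eq i j φ hφ hφc hφU := by
    have := h.integral_eq i j φ hφ hφc (hφU.trans hU)
    rwa [setIntegral_mul_testFunction (hφU.trans hU),
      setIntegral_mul_fderiv_testFunction (hφU.trans hU) (fun x => u x i),
      ← setIntegral_mul_testFunction hφU,
      ← setIntegral_mul_fderiv_testFunction hφU (fun x => u x i)] at this

theorem congr (h : IsW11WithGradient Ω u G) (hΩ : MeasurableSet Ω) (hu : EqOn u u' Ω) :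
    IsW11WithGradient Ω u' G where
  integrableOn := h.integrableOn.congr_fun hu hΩ
  integrableOn_grad := h.integrableOn_grad
  integral_eq i j φ hφ hφc hφU := by
    rw [← h.integral_eq i j φ hφ hφc hφU]
    exact setIntegral_congr_fun hΩ fun x hx => by simp only [hu hx]

theorem add (h : IsW11WithGradient Ω u G) (h' : IsW11WithGradient Ω u' G') :
    IsW11WithGradient Ω (fun x => u x + u' x) (fun x => G x + G' x) where
  integrableOn := h.integrableOn.add h'.integrableOn
  integrableOn_grad i j := (h.integrableOn_grad i j).add (h'.integrableOn_grad i j)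
  integral_eq i j φ hφ hφc hφU := by
    have hd := continuous_fderiv_testFunction hφ (EuclideanSpace.single j 1)
    have hdc := hφc.fderiv_apply (𝕜 := ℝ) (EuclideanSpace.single j 1)
    simp only [PiLp.add_apply, Matrix.add_apply, add_mul]
    rw [integral_add ((h.integrableOn_apply i).mul_testFunction hd hdc)
        ((h'.integrableOn_apply i).mul_testFunction hd hdc),
      integral_add ((h.integrableOn_grad i j).mul_testFunction hφ.continuous hφc)
        ((h'.integrableOn_grad i j).mul_testFunction hφ.continuous hφc),
      h.integral_eq i j φ hφ hφc hφU, h'.integral_eq i j φ hφ hφc hφU, neg_add]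

theorem neg (h : IsW11WithGradient Ω u G) :
    IsW11WithGradient Ω (fun x => - u x) (fun x => - G x) where
  integrableOn := h.integrableOn.neg
  integrableOn_grad i j := (h.integrableOn_grad i j).neg
  integral_eq i j φ hφ hφc hφU := by
    simp only [PiLp.neg_apply, Matrix.neg_apply, neg_mul, integral_neg,
      h.integral_eq i j φ hφ hφc hφU]

theorem sub (h : IsW11WithGradient Ω u G) (h' : IsW11WithGradient Ω u' G') :
    IsW11WithGradient Ω (fun x => u x - u' x) (fun x => G x - G' x) := by
  simpa only [sub_eq_add_neg] using h.add h'.neg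

theorem ae_eq (h : IsW11WithGradient Ω u G) (h' : IsW11WithGradient Ω u G') (hΩ : IsOpen Ω) :
    ∀ᵐ x, x ∈ Ω → G x = G' x := by
  have key : ∀ i j, ∀ᵐ x, x ∈ Ω → G x i j - G' x i j = 0 := by
    intro i j
    refine hΩ.ae_eq_zero_of_integral_contDiff_smul_eq_zero
      ((h.integrableOn_grad i j).sub (h'.integrableOn_grad i j)).locallyIntegrableOn
      fun φ hφ hφc hφU => ?_
    have h1 := h.integral_eq i j φ hφ hφc hφU
    rw [h'.integral_eq i j φ hφ hφc hφU, neg_inj] at h1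
    have h2 := setIntegral_mul_testFunction hφU (fun x => G x i j - G' x i j)
    simp only [smul_eq_mul]
    simp_rw [mul_comm (φ _)]
    rw [← h2]
    simp_rw [sub_mul]
    rw [integral_sub ((h.integrableOn_grad i j).mul_testFunction hφ.continuous hφc)
      ((h'.integrableOn_grad i j).mul_testFunction hφ.continuous hφc), h1, sub_self]
  filter_upwards [ae_all_iff.2 fun i => ae_all_iff.2 fun j => key i j] with x hx hxΩ
  ext i j
  exact sub_eq_zero.1 (hx i j hxΩ)

end IsW11WithGradient

theorem isW11WithGradient_affineMap {Ω : Set (E m)} (hΩ : Bornology.IsBounded Ω) (A : Mat d m)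
    (b : E d) : IsW11WithGradient Ω (affineMap A b) (fun _ => A) where
  integrableOn := ((continuous_affineMap A b).locallyIntegrable.integrableOn_isCompact
    hΩ.isCompact_closure).mono_set subset_closure
  integrableOn_grad i j := integrableOn_const hΩ.measure_lt_top.ne
  integral_eq i j φ hφ hφc hφU := by
    rw [setIntegral_mul_testFunction hφU (fun _ => A i j),
      setIntegral_mul_fderiv_testFunction hφU (fun x => affineMap A b x i)]
    have hd := continuous_fderiv_testFunction hφ (EuclideanSpace.single j 1)
    have hdc := hφc.fderiv_apply (𝕜 := ℝ) (EuclideanSpace.single j 1)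
    have hl : Continuous fun x => affineMap A b x i := by
      have := continuous_affineMap A b; fun_prop
    rw [integral_mul_fderiv_eq_neg_fderiv_mul_of_integrable]
    · simp_rw [fderiv_affineMap_apply]
    · simp_rw [fderiv_affineMap_apply]
      exact (continuous_const.mul hφ.continuous).integrable_of_hasCompactSupport hφc.mul_left
    · exact (hl.mul hd).integrable_of_hasCompactSupport hdc.mul_left
    · exact (hl.mul hφ.continuous).integrable_of_hasCompactSupport hφc.mul_left
    · exact fun x _ => (hasFDerivAt_affineMap_apply A b i x).differentiableAt
    · exact fun x _ => hφ.differentiable (by simp) x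

namespace IsW11WithGradient

variable {Ω : Set (E m)} {u : E m → E d} {G : E m → Mat d m}

/-- `G` is tied to `u` only through integration by parts, so its value on an affine piece has to
come from uniqueness of weak gradients. -/
theorem ae_eq_of_eqOn_affineMap (h : IsW11WithGradient Ω u G) {U : Set (E m)} (hU : IsOpen U)
    (hUb : Bornology.IsBounded U) (hUΩ : U ⊆ Ω) {A : Mat d m} {b : E d}
    (hu : EqOn u (affineMap A b) U) : ∀ᵐ x, x ∈ U → G x = A :=
  ((h.mono hUΩ).congr hU.measurableSet hu).ae_eq (isW11WithGradient_affineMap hUb A b) hU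

/-- Zero boundary values make the extension continuous, so the zero-extension lemma applies to each
coordinate. -/
theorem indicator (h : IsW11WithGradient Ω u G) (hΩ : IsOpen Ω) (hb : Bornology.IsBounded Ω)
    (hu : ContinuousOn u (closure Ω)) (hu0 : ∀ x ∈ frontier Ω, u x = 0) :
    IsW11WithGradient univ (Ω.indicator u) (Ω.indicator G) where
  integrableOn := by
    rw [integrableOn_univ]; exact h.integrableOn.integrable_indicator hΩ.measurableSet
  integrableOn_grad i j := by
    rw [integrableOn_univ]
    refine ((h.integrableOn_grad i j).integrable_indicator hΩ.measurableSet).congr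
      (Eventually.of_forall fun x => ?_)
    by_cases hx : x ∈ Ω <;> simp [hx]
  integral_eq i j φ hφ hφc _ := by
    have hW : Continuous (Ω.indicator u) := continuous_indicator hu0 hu
    have hWi : ∀ x, Ω.indicator u x i = Ω.indicator (fun x => u x i) x := fun x => by
      by_cases hx : x ∈ Ω <;> simp [hx]
    have hGi : ∀ x, Ω.indicator G x i j = Ω.indicator (fun x => G x i j) x := fun x => by
      by_cases hx : x ∈ Ω <;> simp [hx]
    have hWc : Continuous (Ω.indicator fun x => u x i) := by
      have : Continuous fun x => Ω.indicator u x i := by fun_prop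
      simpa only [hWi] using this
    simp only [Measure.restrict_univ, hWi, hGi]
    refine integral_mul_fderiv_of_zero_extension hΩ hWc ?_ (fun x hx => by simp [hx])
      ((h.integrableOn_grad i j).integrable_indicator hΩ.measurableSet) (fun x hx => by simp [hx])
      (fun ψ hψ hψc hψU => ?_) hφ hφc
    · exact HasCompactSupport.intro hb.isCompact_closure fun x hx =>
        indicator_of_notMem (fun h' => hx (subset_closure h')) _
    · rw [← setIntegral_mul_testFunction hψU, ← setIntegral_mul_fderiv_testFunction hψU]
      have := h.integral_eq i j ψ hψ hψc hψU
      refine Eq.trans (setIntegral_congr_fun hΩ.measurableSet fun x hx => ?_)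
        (this.trans (congrArg Neg.neg (setIntegral_congr_fun hΩ.measurableSet fun x hx => ?_)))
      · simp only [indicator_of_mem hx]
      · simp only [indicator_of_mem hx]

/-- Test the original equation with `ψ y = φ (r • y + c)`: the prefactor `r` of `u` is the one from
the chain rule, and both sides gain the same Jacobian. -/
theorem scale (h : IsW11WithGradient univ u G) {r : ℝ} (hr : 0 < r) (c : E m) :
    IsW11WithGradient univ (fun x => r • u (r⁻¹ • (x - c))) (fun x => G (r⁻¹ • (x - c))) where
  integrableOn := by
    rw [integrableOn_univ]
    have h1 := (integrableOn_univ.1 h.integrableOn).comp_smul (inv_ne_zero hr.ne')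
    exact (h1.comp_sub_right c).smul r
  integrableOn_grad i j := by
    rw [integrableOn_univ]
    have h1 := (integrableOn_univ.1 (h.integrableOn_grad i j)).comp_smul (inv_ne_zero hr.ne')
    exact h1.comp_sub_right c
  integral_eq i j φ hφ hφc _ := by
    set v : E m := EuclideanSpace.single j 1
    have hint : ∀ F : E m → ℝ, ∫ x, F (r⁻¹ • (x - c)) = r ^ Module.finrank ℝ (E m) • ∫ x, F x := by
      intro F
      rw [integral_sub_right_eq_self (fun x => F (r⁻¹ • x)) c,
        Measure.integral_comp_inv_smul_of_nonneg _ _ hr.le]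
    have hcan : ∀ x : E m, r • (r⁻¹ • (x - c)) + c = x := fun x => by
      rw [smul_smul, mul_inv_cancel₀ hr.ne', one_smul, sub_add_cancel]
    set ψ : E m → ℝ := fun y => φ (r • y + c) with hψ
    have hψs : ContDiff ℝ ∞ ψ := hφ.comp (by fun_prop)
    have hψc : HasCompactSupport ψ := by
      have := hφc.comp_homeomorph ((Homeomorph.smulOfNeZero r hr.ne').trans (Homeomorph.addRight c))
      exact this
    have hψd : ∀ y, fderiv ℝ ψ y v = r * fderiv ℝ φ (r • y + c) v := by
      intro y
      have h1 : HasFDerivAt (fun y : E m => r • y + c) (r • ContinuousLinearMap.id ℝ (E m)) y :=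
        ((hasFDerivAt_id y).const_smul r).add_const c
      have h2 := ((hφ.differentiable (by simp) (r • y + c)).hasFDerivAt).comp y h1
      rw [hψ]
      erw [h2.fderiv]
      simp
    have key := h.integral_eq i j ψ hψs hψc (subset_univ _)
    simp only [Measure.restrict_univ] at key ⊢
    have e1 : ∀ x, (r • u (r⁻¹ • (x - c))) i * fderiv ℝ φ x v =
        (fun y => u y i * fderiv ℝ ψ y v) (r⁻¹ • (x - c)) := by
      intro x
      simp only [hψd, hcan, PiLp.smul_apply, smul_eq_mul]; ring
    have e2 : ∀ x, G (r⁻¹ • (x - c)) i j * φ x =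
        (fun y => G y i j * ψ y) (r⁻¹ • (x - c)) := by
      intro x
      simp only [hψ, hcan]
    rw [integral_congr_ae (Eventually.of_forall e1), integral_congr_ae (Eventually.of_forall e2)]
    rw [hint (fun y => u y i * fderiv ℝ ψ y v), hint (fun y => G y i j * ψ y), key, smul_neg]

end IsW11WithGradient

/-! ### Countable sums of weakly differentiable functions -/

section Series

variable {ι : Type*} [Countable ι]

theorem integrable_tsum_of_tsum_lintegral_ne_top {X F : Type*} [MeasurableSpace X]
    [NormedAddCommGroup F] [CompleteSpace F] {μ : Measure X} {f : ι → X → F}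
    (hf : ∀ k, AEStronglyMeasurable (f k) μ) (h : ∑' k, ∫⁻ x, ‖f k x‖ₑ ∂μ ≠ ⊤) :
    Integrable (fun x => ∑' k, f k x) μ := by
  refine ⟨AEStronglyMeasurable.tsum hf, ?_⟩
  refine lt_of_le_of_lt (lintegral_mono fun x => enorm_tsum_le_tsum_enorm) ?_
  rw [lintegral_tsum fun k => (hf k).enorm]
  exact h.lt_top

/-- Finite total `L¹` norms and boundedness of test functions and their derivatives allow the sum
and the integral to be exchanged on both sides. -/
theorem isW11WithGradient_tsum {W : ι → E m → E d} {g : ι → E m → Mat d m}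
    (h : ∀ k, IsW11WithGradient univ (W k) (g k)) (hs : ∀ x, Summable fun k => W k x)
    (hW : ∑' k, ∫⁻ x, ‖W k x‖ₑ ≠ ⊤) (hg : ∀ i j, ∑' k, ∫⁻ x, ‖g k x i j‖ₑ ≠ ⊤) :
    IsW11WithGradient univ (fun x => ∑' k, W k x)
      (fun x => Matrix.of fun i j => ∑' k, g k x i j) where
  integrableOn := by
    rw [integrableOn_univ]
    exact integrable_tsum_of_tsum_lintegral_ne_top
      (fun k => (integrableOn_univ.1 (h k).integrableOn).aestronglyMeasurable) hW
  integrableOn_grad i j := by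
    rw [integrableOn_univ]
    exact integrable_tsum_of_tsum_lintegral_ne_top
      (fun k => (integrableOn_univ.1 ((h k).integrableOn_grad i j)).aestronglyMeasurable) (hg i j)
  integral_eq i j φ hφ hφc _ := by
    have hcoord : ∀ x, (∑' k, W k x) i = ∑' k, W k x i := fun x =>
      (EuclideanSpace.proj i : E d →L[ℝ] ℝ).map_tsum (hs x)
    have hd := continuous_fderiv_testFunction hφ (EuclideanSpace.single j 1)
    have hdc := hφc.fderiv_apply (𝕜 := ℝ) (EuclideanSpace.single j 1)
    have swap : ∀ (f : ι → E m → ℝ) (ψ : E m → ℝ), (∀ k, Integrable (f k)) →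
        ∑' k, ∫⁻ x, ‖f k x‖ₑ ≠ ⊤ → Continuous ψ → HasCompactSupport ψ →
        ∫ x, (∑' k, f k x) * ψ x = ∑' k, ∫ x, f k x * ψ x := by
      intro f ψ hf hf' hψ hψc
      simp_rw [← tsum_mul_right]
      refine integral_tsum (fun k => ((hf k).mul_testFunction hψ hψc).aestronglyMeasurable) ?_
      obtain ⟨C, hC⟩ := hψc.exists_bound_of_continuous hψ
      refine ne_top_of_le_ne_top (ENNReal.mul_ne_top hf' (ENNReal.ofReal_ne_top (r := C))) ?_
      rw [← ENNReal.tsum_mul_right]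
      refine ENNReal.tsum_le_tsum fun k => ?_
      rw [← lintegral_mul_const'' _ (hf k).aestronglyMeasurable.enorm]
      refine lintegral_mono fun x => ?_
      rw [enorm_mul]
      gcongr
      rw [← ofReal_norm]
      exact ENNReal.ofReal_le_ofReal (hC x)
    simp only [Measure.restrict_univ, hcoord, Matrix.of_apply]
    have hWi : ∑' k, ∫⁻ x, ‖W k x i‖ₑ ≠ ⊤ := by
      refine ne_top_of_le_ne_top hW (ENNReal.tsum_le_tsum fun k => lintegral_mono fun x => ?_)
      rw [← ofReal_norm, ← ofReal_norm]
      exact ENNReal.ofReal_le_ofReal (PiLp.norm_apply_le (W k x) i)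
    rw [swap (fun k x => W k x i) _ (fun k => integrableOn_univ.1 ((h k).integrableOn_apply i)) hWi
        hd hdc,
      swap (fun k x => g k x i j) _ (fun k => integrableOn_univ.1 ((h k).integrableOn_grad i j))
        (hg i j) hφ.continuous hφc, ← tsum_neg]
    congr 1; ext k
    simpa using (h k).integral_eq i j φ hφ hφc (subset_univ _)

end Series

end WeakReduction

namespace WeakReduction

open Filter Topology

variable {d m : ℕ}

/-! ### Hölder continuity under extension and gluing -/

section Holder

variable {X Y : Type*} [PseudoMetricSpace X] [SeminormedAddCommGroup Y] {H H' α : ℝ≥0} {f g : X → Y}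
  {S : Set X}

theorem holderOnWith_of_dist_le
    (h : ∀ x ∈ S, ∀ y ∈ S, dist (f x) (f y) ≤ H * dist x y ^ (α : ℝ)) : HolderOnWith H α f S := by
  intro x hx y hy
  rw [edist_nndist, edist_nndist, ← ENNReal.coe_rpow_of_nonneg _ α.coe_nonneg]
  have := h x hx y hy
  rw [← coe_nndist, ← coe_nndist] at this
  exact_mod_cast this

theorem holderWith_of_dist_le (h : ∀ x y, dist (f x) (f y) ≤ H * dist x y ^ (α : ℝ)) :
    HolderWith H α f :=
  holderOnWith_univ.1 (holderOnWith_of_dist_le fun x _ y _ => h x y)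

theorem _root_.HolderOnWith.add (hf : HolderOnWith H α f S) (hg : HolderOnWith H' α g S) :
    HolderOnWith (H + H') α (fun x => f x + g x) S :=
  holderOnWith_of_dist_le fun x hx y hy => by
    have h1 := hf.dist_le hx hy
    have h2 := hg.dist_le hx hy
    have h3 := dist_add_add_le (f x) (g x) (f y) (g y)
    push_cast
    linarith

theorem _root_.HolderOnWith.neg (hf : HolderOnWith H α f S) :
    HolderOnWith H α (fun x => - f x) S :=
  holderOnWith_of_dist_le fun x hx y hy => by
    simpa [dist_neg_neg] using hf.dist_le hx hy

/-- For points in two different supports, each summand vanishes at the other's point. Passing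
through `0` costs one Hölder estimate per summand, hence the factor 2 however many summands there
are. -/
theorem holderWith_of_disjoint_support {ι : Type*} {W : ι → X → Y} {Z : X → Y} {U : ι → Set X}
    (hW : ∀ k, HolderWith H α (W k)) (hW0 : ∀ k, ∀ x ∉ U k, W k x = 0)
    (hU : Pairwise fun k l => Disjoint (U k) (U l)) (hZ : ∀ k, ∀ x ∈ U k, Z x = W k x)
    (hZ0 : ∀ x, (∀ k, x ∉ U k) → Z x = 0) : HolderWith (2 * H) α Z := by
  refine holderWith_of_dist_le fun x y => ?_
  have hpos : 0 ≤ (H : ℝ) * dist x y ^ (α : ℝ) := by positivity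
  push_cast
  rw [mul_assoc, two_mul]
  by_cases hx : ∃ k, x ∈ U k
  · obtain ⟨k, hk⟩ := hx
    have h1 := (hW k).dist_le x y
    by_cases hy : ∃ l, y ∈ U l
    · obtain ⟨l, hl⟩ := hy
      by_cases hkl : k = l
      · subst hkl
        rw [hZ k x hk, hZ k y hl]; linarith
      · have hxl : W l x = 0 := hW0 l x fun h => disjoint_left.1 (hU hkl) hk h
        have hyk : W k y = 0 := hW0 k y fun h => disjoint_left.1 (hU hkl) h hl
        have h2 := (hW l).dist_le x y
        rw [hZ k x hk, hZ l y hl]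
        rw [hyk] at h1
        rw [hxl] at h2
        linarith [dist_triangle (W k x) 0 (W l y)]
    · rw [hZ k x hk, hZ0 y (not_exists.1 hy), ← hW0 k y (not_exists.1 hy k)]; linarith
  · by_cases hy : ∃ l, y ∈ U l
    · obtain ⟨l, hl⟩ := hy
      have h2 := (hW l).dist_le x y
      rw [hZ l y hl, hZ0 x (not_exists.1 hx), ← hW0 l x (not_exists.1 hx l)]; linarith
    · rw [hZ0 x (not_exists.1 hx), hZ0 y (not_exists.1 hy), dist_self]; linarith

theorem exists_mem_segment_frontier {V : Type*} [NormedAddCommGroup V] [NormedSpace ℝ V]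
    {U : Set V} (hU : IsOpen U) {x y : V} (hx : x ∈ U) (hy : y ∉ U) :
    ∃ z ∈ segment ℝ x y, z ∈ frontier U := by
  by_contra! h
  have hyc : y ∉ closure U := fun hc =>
    h y (right_mem_segment ℝ x y) (by rw [hU.frontier_eq]; exact ⟨hc, hy⟩)
  obtain ⟨z, -, hz1, hz2⟩ := (convex_segment x y).isPreconnected U (closure U)ᶜ hU
    isClosed_closure.isOpen_compl
    (fun z hz => by
      by_cases hzU : z ∈ U
      · exact Or.inl hzU
      · refine Or.inr fun hc => h z hz ?_
        rw [hU.frontier_eq]; exact ⟨hc, hzU⟩)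
    ⟨x, left_mem_segment ℝ x y, hx⟩ ⟨y, right_mem_segment ℝ x y, hyc⟩
  exact hz2 (subset_closure hz1)

/-- The segment from an inside point to an outside point meets the frontier, where `f` vanishes, at
no greater distance; the Hölder constant is therefore unchanged. -/
theorem holderWith_indicator {V : Type*} [NormedAddCommGroup V] [NormedSpace ℝ V]
    {U : Set V} (hU : IsOpen U) {f : V → Y} (hf : HolderOnWith H α f (closure U))
    (hf0 : ∀ x ∈ frontier U, f x = 0) : HolderWith H α (U.indicator f) := by
  have key : ∀ x y, x ∈ U → y ∉ U →
      dist (U.indicator f x) (U.indicator f y) ≤ H * dist x y ^ (α : ℝ) := by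
    intro x y hx hy
    obtain ⟨z, hz, hzU⟩ := exists_mem_segment_frontier hU hx hy
    rw [indicator_of_mem hx, indicator_of_notMem hy, ← hf0 z hzU]
    refine (hf.dist_le (subset_closure hx) (frontier_subset_closure hzU)).trans ?_
    gcongr
    rw [← dist_add_dist_of_mem_segment hz]
    linarith [dist_nonneg (x := z) (y := y)]
  refine holderWith_of_dist_le fun x y => ?_
  by_cases hx : x ∈ U
  · by_cases hy : y ∈ U
    · rw [indicator_of_mem hx, indicator_of_mem hy]
      exact hf.dist_le (subset_closure hx) (subset_closure hy)
    · exact key x y hx hy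
  · by_cases hy : y ∈ U
    · rw [dist_comm, dist_comm x]; exact key y x hy hx
    · rw [indicator_of_notMem hx, indicator_of_notMem hy, dist_self]; positivity

theorem exists_holderOnWith_affineMap (A : Mat d m) (b : E d) {S : Set (E m)}
    (hS : Bornology.IsBounded S) (hα : α ≤ 1) : ∃ H : ℝ≥0, HolderOnWith H α (affineMap A b) S := by
  let L : E m →L[ℝ] E d := LinearMap.toContinuousLinearMap (Matrix.toEuclideanLin A)
  have hL : ∀ x, affineMap A b x = L x + b := fun x => rfl
  have hlip : LipschitzWith ‖L‖₊ (affineMap A b) := by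
    refine LipschitzWith.of_dist_le_mul fun x y => ?_
    rw [hL, hL, dist_add_right]
    exact L.lipschitz.dist_le_mul x y
  obtain ⟨D, hD⟩ := Metric.isBounded_iff.1 hS
  refine ⟨_, HolderOnWith.of_le (D := D.toNNReal) (fun x hx y hy => ?_)
    (holderOnWith_one.2 (hlip.lipschitzOnWith (s := S))) hα⟩
  rw [edist_dist]
  exact ENNReal.ofReal_le_ofReal (hD hx hy)

end Holder

/-! ### Homotheties -/

section Scaling

/-- The homothety mapping `ball c r` onto the unit ball. -/
noncomputable def unscale {r : ℝ} (hr : 0 < r) (c : E m) : E m ≃ₜ E m :=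
  (Homeomorph.subRight c).trans (Homeomorph.smulOfNeZero r⁻¹ (inv_ne_zero hr.ne'))

variable {r : ℝ} (hr : 0 < r) (c : E m)

theorem unscale_apply (x : E m) : unscale hr c x = r⁻¹ • (x - c) := rfl

theorem dist_unscale (x y : E m) : dist (unscale hr c x) (unscale hr c y) = r⁻¹ * dist x y := by
  rw [unscale_apply, unscale_apply, dist_smul₀, dist_sub_right, Real.norm_of_nonneg (by positivity)]

theorem unscale_preimage_ball : unscale hr c ⁻¹' Metric.ball 0 1 = Metric.ball c r := by
  ext x
  rw [mem_preimage, Metric.mem_ball, Metric.mem_ball,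
    show (0 : E m) = unscale hr c c by simp [unscale_apply], dist_unscale, inv_mul_lt_one₀ hr]

theorem measurePreserving_unscale :
    MeasurePreserving (unscale hr c) volume
      (ENNReal.ofReal (r ^ Module.finrank ℝ (E m)) • volume) := by
  refine ⟨(unscale hr c).continuous.measurable, ?_⟩
  ext s hs
  rw [Measure.map_apply (unscale hr c).continuous.measurable hs]
  have : unscale hr c ⁻¹' s = (fun x => x - c) ⁻¹' ((fun x => r⁻¹ • x) ⁻¹' s) := rfl
  simp_rw [sub_eq_add_neg] at this
  rw [this, measure_preimage_add_right, Measure.addHaar_preimage_smul _ (inv_ne_zero hr.ne'),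
    Measure.smul_apply, smul_eq_mul, inv_pow, inv_inv, abs_of_nonneg (by positivity)]

theorem volume_preimage_unscale (s : Set (E m)) :
    volume (unscale hr c ⁻¹' s) = ENNReal.ofReal (r ^ Module.finrank ℝ (E m)) * volume s :=
  (measurePreserving_unscale hr c).measure_preimage_emb
    (unscale hr c).measurableEmbedding s

theorem setLIntegral_preimage_unscale (F : E m → ℝ≥0∞) (s : Set (E m)) :
    ∫⁻ x in unscale hr c ⁻¹' s, F (unscale hr c x) =
      ENNReal.ofReal (r ^ Module.finrank ℝ (E m)) * ∫⁻ x in s, F x := by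
  rw [(measurePreserving_unscale hr c).setLIntegral_comp_preimage_emb
    (unscale hr c).measurableEmbedding, Measure.restrict_smul, lintegral_smul_measure, smul_eq_mul]

variable {hr c} in
theorem IsRegularDomain.preimage_unscale {U : Set (E m)} (hU : IsRegularDomain U) :
    IsRegularDomain (unscale hr c ⁻¹' U) where
  isOpen := hU.isOpen.preimage (unscale hr c).continuous
  isBounded := by
    obtain ⟨D, hD⟩ := Metric.isBounded_iff.1 hU.isBounded
    refine Metric.isBounded_iff.2 ⟨r * D, fun x hx y hy => ?_⟩
    have := hD hx hy
    rwa [dist_unscale, inv_mul_le_iff₀ hr] at this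
  isConnected := (unscale hr c).isConnected_preimage.2 hU.isConnected
  volume_frontier := by
    rw [← Homeomorph.preimage_frontier, volume_preimage_unscale, hU.volume_frontier, mul_zero]

theorem IsPiecewiseAffine.scale {Ω : Set (E m)} {u : E m → E d} (hu : IsPiecewiseAffine Ω u) :
    IsPiecewiseAffine (unscale hr c ⁻¹' Ω) fun x => r • u (unscale hr c x) := by
  obtain ⟨P, hPc, hPd, hP, hPv⟩ := hu
  refine ⟨preimage (unscale hr c) '' P, hPc.image _, ?_, ?_, ?_⟩
  · rintro _ ⟨U, hU, rfl⟩ _ ⟨U', hU', rfl⟩ hne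
    exact (hPd hU hU' fun h => hne (by rw [h])).preimage _
  · rintro _ ⟨U, hU, rfl⟩
    obtain ⟨h1, h2, A, b, h3⟩ := hP U hU
    refine ⟨h1.preimage_unscale, preimage_mono h2, A, r • b - affineMap A 0 c, fun x hx => ?_⟩
    simp only [h3 hx]
    rw [unscale_apply, smul_affineMap_smul_sub A b hr.ne']
  · have : unscale hr c ⁻¹' Ω \ ⋃₀ (preimage (unscale hr c) '' P) =
        unscale hr c ⁻¹' (Ω \ ⋃₀ P) := by
      rw [preimage_sdiff, sUnion_image, preimage_sUnion]
    rw [this, volume_preimage_unscale, hPv, mul_zero]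

end Scaling

/-! ### Patches on balls -/

section Patch

open Metric

theorem isRegularDomain_ball (c : E m) {r : ℝ} (hr : 0 < r) : IsRegularDomain (ball c r) where
  isOpen := isOpen_ball
  isBounded := isBounded_ball
  isConnected := (convex_ball c r).isConnected (nonempty_ball.2 hr)
  volume_frontier := by
    rw [frontier_ball c hr.ne']; exact Measure.addHaar_sphere_of_ne_zero _ _ hr.ne'

/-- A perturbation, supported in `ball c r`, of an affine map with gradient `A`. -/
structure IsPatch (K : Set (Mat d m)) (A : Mat d m) (q C ε s : ℝ) (α H : ℝ≥0) (B : ℝ) (c : E m)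
    (r : ℝ) (W : E m → E d) (g : E m → Mat d m) : Prop where
  w11 : IsW11WithGradient univ W g
  eq_zero : ∀ x ∉ ball c r, W x = 0
  grad_eq_zero : ∀ x ∉ ball c r, g x = 0
  holder : HolderWith H α W
  norm_le : ∀ x, ‖W x‖ ≤ B
  piecewise : IsPiecewiseAffine (ball c r) W
  error_le : ∫⁻ x in {x ∈ ball c r | A + g x ∉ K}, ENNReal.ofReal ((1 + matNorm (A + g x)) ^ s)
    ≤ ENNReal.ofReal ε * volume (ball c r)
  distrib_le : ∀ t : ℝ, 0 < t → volume {x ∈ ball c r | t < matNorm (A + g x)}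
    ≤ ENNReal.ofReal (C * (1 + matNorm A ^ q) * t ^ (-q)) * volume (ball c r)

variable {K K' : Set (Mat d m)} {A : Mat d m} {q C ε s : ℝ} {α : ℝ≥0}

/-- A solution on the unit ball minus its boundary affine map vanishes on the sphere, so its
extension by zero is Hölder and weakly differentiable on the whole space. -/
theorem ReductionBound.exists_isPatch_unit (h : ReductionBound K K' q C) (hA : A ∈ K)
    (hε : 0 < ε) (hε1 : ε < 1) (hα : 0 < α) (hα1 : α < 1) (hs : 1 < s) :
    ∃ (H : ℝ≥0) (B : ℝ) (W : E m → E d) (g : E m → Mat d m),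
      IsPatch K' A q C ε s α H B 0 1 W g := by
  have hball := isRegularDomain_ball (0 : E m) one_pos
  -- The translation `b = 0` suffices, since the boundary affine map is subtracted anyway.
  obtain ⟨u, G, hpa, hw, ⟨H, hH⟩, hbd, herr, hdist⟩ :=
    h A hA 0 ε α s hε hε1 hα hα1 hs _ hball
  obtain ⟨H', hH'⟩ := exists_holderOnWith_affineMap A 0 (isBounded_ball (x := (0 : E m)) (r := 1)).closure
    hα1.le
  have hhold : HolderOnWith (H + H') α (fun x => u x - affineMap A 0 x) (closure (ball 0 1)) := by
    simpa only [sub_eq_add_neg] using hH.add hH'.neg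
  have hzero : ∀ x ∈ frontier (ball (0 : E m) 1), u x - affineMap A 0 x = 0 := fun x hx => by
    rw [hbd hx, sub_self]
  have hhold' := holderWith_indicator hball.isOpen hhold hzero
  have hcs : HasCompactSupport ((ball (0 : E m) 1).indicator fun x => u x - affineMap A 0 x) :=
    HasCompactSupport.intro hball.isBounded.isCompact_closure fun x hx =>
      indicator_of_notMem (fun h' => hx (subset_closure h')) _
  obtain ⟨B, hB⟩ := hcs.exists_bound_of_continuous (hhold'.continuous hα)
  have hgrad : ∀ x ∈ ball (0 : E m) 1, A + (ball (0 : E m) 1).indicator (fun x => G x - A) x = G x :=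
    fun x hx => by rw [indicator_of_mem hx, add_sub_cancel]
  refine ⟨H + H', B, (ball 0 1).indicator fun x => u x - affineMap A 0 x,
    (ball 0 1).indicator fun x => G x - A, ?_, fun x hx => indicator_of_notMem hx _,
    fun x hx => indicator_of_notMem hx _, hhold', hB, ?_, ?_, ?_⟩
  · exact (hw.sub (isW11WithGradient_affineMap hball.isBounded A 0)).indicator hball.isOpen
      hball.isBounded (hhold.continuousOn hα) hzero
  · obtain ⟨P, hPc, hPd, hP, hPv⟩ := hpa
    refine ⟨P, hPc, hPd, fun U hU => ?_, hPv⟩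
    obtain ⟨h1, h2, A', b', h3⟩ := hP U hU
    refine ⟨h1, h2, A' - A, b' - 0, fun x hx => ?_⟩
    rw [indicator_of_mem (h2 hx), h3 hx, affineMap_sub_affineMap]
  · have hset : {x ∈ ball (0 : E m) 1 | A + (ball (0 : E m) 1).indicator (fun x => G x - A) x ∉ K'} =
        {x ∈ ball (0 : E m) 1 | G x ∉ K'} := by
      ext x
      simp only [mem_sep_iff]
      exact and_congr_right fun hx => by rw [hgrad x hx]
    rw [hset]
    refine le_trans (le_of_eq ?_) herr.le
    refine lintegral_congr_ae ?_
    have : ∀ᵐ x ∂(volume.restrict (ball (0 : E m) 1)),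
        ENNReal.ofReal ((1 + matNorm (A + (ball (0 : E m) 1).indicator (fun x => G x - A) x)) ^ s) =
        ENNReal.ofReal ((1 + matNorm (G x)) ^ s) := by
      filter_upwards [ae_restrict_mem measurableSet_ball] with x hx
      rw [hgrad x hx]
    exact ae_restrict_of_ae_restrict_of_subset (sep_subset _ _) this
  · intro t ht
    have hset : {x ∈ ball (0 : E m) 1 |
        t < matNorm (A + (ball (0 : E m) 1).indicator (fun x => G x - A) x)} =
        {x ∈ ball (0 : E m) 1 | t < matNorm (G x)} := by
      ext x
      simp only [mem_sep_iff]
      exact and_congr_right fun hx => by rw [hgrad x hx]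
    rw [hset]
    exact hdist t ht

/-- The values scale by `r` and the variable by `r⁻¹`, so gradients are transported unchanged and
the estimates relative to the volume of the ball persist. -/
theorem IsPatch.scale {H : ℝ≥0} {B : ℝ} {W : E m → E d} {g : E m → Mat d m}
    (h : IsPatch K A q C ε s α H B 0 1 W g) (c : E m) {r : ℝ} (hr : 0 < r) :
    IsPatch K A q C ε s α (H * (r ^ (1 - α : ℝ)).toNNReal) (r * B) c r
      (fun x => r • W (unscale hr c x)) (fun x => g (unscale hr c x)) where
  w11 := h.w11.scale hr c
  eq_zero x hx := by
    rw [← unscale_preimage_ball hr c] at hx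
    rw [h.eq_zero _ hx, smul_zero]
  grad_eq_zero x hx := by
    rw [← unscale_preimage_ball hr c] at hx
    exact h.grad_eq_zero _ hx
  holder := by
    refine holderWith_of_dist_le fun x y => ?_
    have h1 := h.holder.dist_le (unscale hr c x) (unscale hr c y)
    rw [dist_unscale, Real.mul_rpow (by positivity) dist_nonneg, Real.inv_rpow hr.le] at h1
    rw [dist_smul₀, Real.norm_of_nonneg hr.le, NNReal.coe_mul,
      Real.coe_toNNReal _ (by positivity), Real.rpow_sub hr, Real.rpow_one]
    calc _ ≤ r * (H * ((r ^ (α : ℝ))⁻¹ * dist x y ^ (α : ℝ))) := by gcongr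
      _ = _ := by ring
  norm_le x := by
    rw [norm_smul, Real.norm_of_nonneg hr.le]
    gcongr
    exact h.norm_le _
  piecewise := by
    rw [← unscale_preimage_ball hr c]; exact h.piecewise.scale hr c
  error_le := by
    rw [← unscale_preimage_ball hr c, volume_preimage_unscale]
    have := setLIntegral_preimage_unscale hr c
      (fun x => ENNReal.ofReal ((1 + matNorm (A + g x)) ^ s)) {x ∈ ball 0 1 | A + g x ∉ K}
    refine (le_of_eq this).trans ?_
    rw [mul_left_comm]
    gcongr
    exact h.error_le
  distrib_le t ht := by
    rw [← unscale_preimage_ball hr c, volume_preimage_unscale]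
    have := volume_preimage_unscale hr c {x ∈ ball 0 1 | t < matNorm (A + g x)}
    refine (le_of_eq this).trans ?_
    rw [mul_left_comm]
    gcongr
    exact h.distrib_le t ht

theorem IsPatch.mono {H H' : ℝ≥0} {B B' : ℝ} {c : E m} {r : ℝ} {W : E m → E d}
    {g : E m → Mat d m} (h : IsPatch K A q C ε s α H B c r W g) (hH : H ≤ H') (hB : B ≤ B') :
    IsPatch K A q C ε s α H' B' c r W g :=
  { h with holder := h.holder.mono hH, norm_le := fun x => (h.norm_le x).trans hB }

/-- Since `α < 1`, both `H * r ^ (1 - α)` and `r * B` tend to zero with `r`. The threshold `R`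
depends on `A`, but the resulting bounds 1 do not, so infinitely many patches with different
gradients can be summed. -/
theorem ReductionBound.exists_isPatch (h : ReductionBound K K' q C) (hA : A ∈ K)
    (hε : 0 < ε) (hε1 : ε < 1) (hα : 0 < α) (hα1 : α < 1) (hs : 1 < s) :
    ∃ R : ℝ, 0 < R ∧ ∀ (c : E m) (r : ℝ), 0 < r → r < R →
      ∃ (W : E m → E d) (g : E m → Mat d m), IsPatch K' A q C ε s α 1 1 c r W g := by
  obtain ⟨H, B, W, g, hp⟩ := h.exists_isPatch_unit hA hε hε1 hα hα1 hs
  have hα1' : (0 : ℝ) < 1 - α := by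
    have : (α : ℝ) < 1 := by exact_mod_cast hα1
    linarith
  have l1 : Tendsto (fun r : ℝ => (H : ℝ) * r ^ (1 - α : ℝ)) (𝓝 0) (𝓝 (H * 0 ^ (1 - α : ℝ))) :=
    ((Real.continuous_rpow_const hα1'.le).tendsto 0).const_mul _
  have l2 : Tendsto (fun r : ℝ => r * B) (𝓝 0) (𝓝 (0 * B)) := tendsto_id.mul_const _
  rw [Real.zero_rpow hα1'.ne', mul_zero] at l1
  rw [zero_mul] at l2
  obtain ⟨R, hR, hRs⟩ := Metric.eventually_nhds_iff.1
    ((l1.eventually (gt_mem_nhds one_pos)).and (l2.eventually (gt_mem_nhds one_pos)))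
  refine ⟨R, hR, fun c r hr hrR => ?_⟩
  obtain ⟨h1, h2⟩ := hRs (y := r) (by rwa [Real.dist_eq, sub_zero, abs_of_pos hr])
  refine ⟨_, _, (hp.scale c hr).mono ?_ h2.le⟩
  rw [← NNReal.coe_le_coe, NNReal.coe_mul, Real.coe_toNNReal _ (by positivity)]
  exact h1.le

end Patch

end WeakReduction

namespace WeakReduction

open Filter Topology

/-! ### Integrals of functions in weak `L^p` -/

section WeakLp

theorem lintegral_Ioc_rpow_sub_one {k a : ℝ} (hk : 0 < k) (ha : 0 ≤ a) :
    ∫⁻ t in Ioc 0 a, ENNReal.ofReal (t ^ (k - 1)) = ENNReal.ofReal (a ^ k / k) := by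
  have hi : IntegrableOn (fun t : ℝ => t ^ (k - 1)) (Ioc 0 a) :=
    (intervalIntegrable_iff_integrableOn_Ioc_of_le ha).1
      (intervalIntegral.intervalIntegrable_rpow' (by linarith))
  rw [← ofReal_integral_eq_lintegral_ofReal hi, ← intervalIntegral.integral_of_le ha,
    integral_rpow (Or.inl (by linarith)), sub_add_cancel, Real.zero_rpow hk.ne', sub_zero]
  filter_upwards [ae_restrict_mem measurableSet_Ioc] with t ht
  exact Real.rpow_nonneg ht.1.le _

theorem lintegral_Ioi_rpow_neg_sub_one {k a : ℝ} (hk : 0 < k) (ha : 0 < a) :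
    ∫⁻ t in Ioi a, ENNReal.ofReal (t ^ (-k - 1)) = ENNReal.ofReal (a ^ (-k) / k) := by
  rw [← ofReal_integral_eq_lintegral_ofReal (integrableOn_Ioi_rpow_of_lt (by linarith) ha),
    integral_Ioi_rpow_of_lt (by linarith) ha, sub_add_cancel, neg_div_neg_eq]
  filter_upwards [ae_restrict_mem measurableSet_Ioi] with t ht
  exact Real.rpow_nonneg (ha.trans ht).le _

variable {X : Type*} [MeasurableSpace X] {μ : Measure X} {f : X → ℝ} {p q B : ℝ} {v : ℝ≥0∞}

/-- In the layer-cake formula the truncation stops the integral at `a`, and `t ^ (q - p - 1)` is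
integrable at zero because `p < q`. -/
theorem lintegral_min_rpow_le_of_weak (hf0 : ∀ x, 0 ≤ f x) (hf : AEMeasurable f μ) (hp : 0 < p)
    (hpq : p < q) (hB : 0 ≤ B)
    (h : ∀ t, 0 < t → μ {x | t < f x} ≤ ENNReal.ofReal (B * t ^ (-p)) * v) {a : ℝ} (ha : 0 < a) :
    ∫⁻ x, ENNReal.ofReal (min (f x) a ^ q) ∂μ ≤
      ENNReal.ofReal (B * a ^ (q - p) * (q / (q - p))) * v := by
  have hq : 0 < q := hp.trans hpq
  have hk : 0 < q - p := sub_pos.2 hpq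
  rw [lintegral_rpow_eq_lintegral_meas_lt_mul μ
    (Eventually.of_forall fun x => le_min (hf0 x) ha.le) (hf.min aemeasurable_const) hq]
  have hb : ∀ t ∈ Ioi (0 : ℝ), μ {x | t < min (f x) a} * ENNReal.ofReal (t ^ (q - 1)) ≤
      (Ioc 0 a).indicator (fun t => ENNReal.ofReal B * v * ENNReal.ofReal (t ^ (q - p - 1))) t := by
    intro t ht
    by_cases hta : t ≤ a
    · rw [indicator_of_mem (show t ∈ Ioc 0 a from ⟨ht, hta⟩)]
      have h1 : μ {x | t < min (f x) a} ≤ ENNReal.ofReal (B * t ^ (-p)) * v :=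
        by
        refine le_trans (measure_mono fun x (hx : t < min (f x) a) => ?_) (h t ht)
        exact (lt_min_iff.1 hx).1
      calc _ ≤ ENNReal.ofReal (B * t ^ (-p)) * v * ENNReal.ofReal (t ^ (q - 1)) := by gcongr
        _ = ENNReal.ofReal B * v * (ENNReal.ofReal (t ^ (-p)) * ENNReal.ofReal (t ^ (q - 1))) := by
          rw [ENNReal.ofReal_mul hB]; ring
        _ = _ := by
          rw [← ENNReal.ofReal_mul (Real.rpow_nonneg (le_of_lt ht) _), ← Real.rpow_add ht]
          congr 3; ring
    · have : {x | t < min (f x) a} = ∅ := by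
        ext x
        simpa using fun _ => (not_le.1 hta).le
      rw [this]; simp
  calc _ ≤ ENNReal.ofReal q * ∫⁻ t in Ioi 0, (Ioc 0 a).indicator
        (fun t => ENNReal.ofReal B * v * ENNReal.ofReal (t ^ (q - p - 1))) t := by
        gcongr ENNReal.ofReal q * ?_
        exact setLIntegral_mono' measurableSet_Ioi hb
    _ ≤ ENNReal.ofReal q * ∫⁻ t, (Ioc 0 a).indicator
        (fun t => ENNReal.ofReal B * v * ENNReal.ofReal (t ^ (q - p - 1))) t := by
        gcongr
        exact Measure.restrict_le_self
    _ = ENNReal.ofReal q * (ENNReal.ofReal B * v * ENNReal.ofReal (a ^ (q - p) / (q - p))) := by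
        rw [lintegral_indicator measurableSet_Ioc, lintegral_const_mul _ (by fun_prop),
          lintegral_Ioc_rpow_sub_one hk ha.le]
    _ = _ := by
        have : B * a ^ (q - p) * (q / (q - p)) = q * B * (a ^ (q - p) / (q - p)) := by ring
        rw [this, ENNReal.ofReal_mul (by positivity), ENNReal.ofReal_mul hq.le]
        ring

theorem lintegral_rpow_le_of_weak (hf0 : ∀ x, 0 ≤ f x) (hf : AEMeasurable f μ) (hq : 0 < q)
    (hqp : q < p) (hB : 0 < B) (hv : μ univ ≤ v)
    (h : ∀ t, 0 < t → μ {x | t < f x} ≤ ENNReal.ofReal (B * t ^ (-p)) * v) :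
    ∫⁻ x, ENNReal.ofReal (f x ^ q) ∂μ ≤ ENNReal.ofReal (B ^ (q / p) * (1 + q / (p - q))) * v := by
  have hp : 0 < p := hq.trans hqp
  have hk : 0 < p - q := sub_pos.2 hqp
  -- The level where `B * a ^ (-p) = 1`: below it the trivial bound `v` is the better one, above it
  -- the weak bound.
  set a : ℝ := B ^ (1 / p) with ha_def
  have ha : 0 < a := by positivity
  have hap : a ^ p = B := by rw [ha_def, ← Real.rpow_mul hB.le]; simp [hp.ne']
  have haq : a ^ q = B ^ (q / p) := by
    rw [ha_def, ← Real.rpow_mul hB.le]; congr 1; ring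
  rw [lintegral_rpow_eq_lintegral_meas_lt_mul μ (Eventually.of_forall hf0) hf hq,
    ← Ioc_union_Ioi_eq_Ioi ha.le]
  have h1 : ∫⁻ t in Ioc 0 a, μ {x | t < f x} * ENNReal.ofReal (t ^ (q - 1)) ≤
      v * ENNReal.ofReal (a ^ q / q) := by
    rw [← lintegral_Ioc_rpow_sub_one hq ha.le, ← lintegral_const_mul _ (by fun_prop)]
    refine lintegral_mono fun t => ?_
    gcongr
    exact (measure_mono (subset_univ _)).trans hv
  have h2 : ∫⁻ t in Ioi a, μ {x | t < f x} * ENNReal.ofReal (t ^ (q - 1)) ≤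
      ENNReal.ofReal B * v * ENNReal.ofReal (a ^ (-(p - q)) / (p - q)) := by
    rw [← lintegral_Ioi_rpow_neg_sub_one hk ha, ← lintegral_const_mul _ (by fun_prop)]
    refine setLIntegral_mono' measurableSet_Ioi fun t ht => ?_
    have ht0 : 0 < t := ha.trans ht
    calc _ ≤ ENNReal.ofReal (B * t ^ (-p)) * v * ENNReal.ofReal (t ^ (q - 1)) := by
          gcongr; exact h t ht0
      _ = ENNReal.ofReal B * v * (ENNReal.ofReal (t ^ (-p)) * ENNReal.ofReal (t ^ (q - 1))) := by
        rw [ENNReal.ofReal_mul hB.le]; ring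
      _ = _ := by
        rw [← ENNReal.ofReal_mul (Real.rpow_nonneg ht0.le _), ← Real.rpow_add ht0]
        congr 3; ring
  calc _ ≤ ENNReal.ofReal q * (v * ENNReal.ofReal (a ^ q / q) +
        ENNReal.ofReal B * v * ENNReal.ofReal (a ^ (-(p - q)) / (p - q))) := by
        gcongr
        exact (lintegral_union_le _ _ _).trans (add_le_add h1 h2)
    _ = (ENNReal.ofReal (q * (a ^ q / q)) +
        ENNReal.ofReal (q * B * (a ^ (-(p - q)) / (p - q)))) * v := by
        rw [ENNReal.ofReal_mul hq.le, ENNReal.ofReal_mul (by positivity), ENNReal.ofReal_mul hq.le]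
        ring
    _ = _ := by
        rw [← ENNReal.ofReal_add (by positivity) (by positivity), ← haq]
        congr 2
        have : B * a ^ (-(p - q)) = a ^ q := by
          rw [← hap, ← Real.rpow_add ha]; congr 1; ring
        calc _ = a ^ q * (q / q) + q * (B * a ^ (-(p - q))) / (p - q) := by ring
          _ = _ := by rw [this, div_self hq.ne']; ring

theorem min_one_add_le {x y : ℝ} (hx : 0 ≤ x) (hy : 0 ≤ y) : min 1 (x + y) ≤ min 1 x + min 1 y := by
  rcases le_total 1 x with h | h <;> rcases le_total 1 y with h' | h' <;>
    simp only [min_eq_left, min_eq_right, h, h']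
  · exact (min_le_left _ _).trans (by linarith)
  · exact (min_le_left _ _).trans (by linarith)
  · exact (min_le_left _ _).trans (by linarith)
  · exact min_le_right _ _

theorem min_one_rpow_neg_le {a r q : ℝ} (ha : 0 < a) (hr : 0 ≤ r) (hrq : r ≤ q) :
    min 1 (a ^ (-q)) ≤ a ^ (-r) := by
  rcases le_total 1 a with h | h
  · exact (min_le_right _ _).trans (Real.rpow_le_rpow_of_exponent_le h (by linarith))
  · exact (min_le_left _ _).trans
      (Real.one_le_rpow_of_pos_of_le_one_of_nonpos ha h (by linarith))

/-- With `a = t / M''` the integrand is `min 1 (a^(-q) + (f/a)^q)`. The constant term contributes 1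
to the coefficient. For `p < q` the power term is integrated with `f` truncated at `a`; for `q < p`
the minimum is dropped and `f ^ q` is integrable. Either way it contributes at most `1 + q / |q -
p|`. -/
theorem lintegral_min_one_le_of_weak {M' M'' N : ℝ} (hp : 1 ≤ p) (hq : 1 < q) (hpq : p ≠ q)
    (hM' : 1 ≤ M') (hM'' : 1 ≤ M'') (hN : 0 ≤ N) (hf0 : ∀ x, 0 ≤ f x) (hf : AEMeasurable f μ)
    (hv : μ univ ≤ v)
    (h : ∀ t, 0 < t → μ {x | t < f x} ≤ ENNReal.ofReal (M' ^ p * (1 + N ^ p) * t ^ (-p)) * v)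
    {t : ℝ} (ht : 0 < t) :
    ∫⁻ x, ENNReal.ofReal (min 1 (M'' ^ q * (1 + f x ^ q) * t ^ (-q))) ∂μ ≤
      ENNReal.ofReal ((2 + q / |q - p|) *
        ((M' * M'') ^ (min p q) * (1 + N ^ (min p q)) * t ^ (-(min p q)))) * v := by
  have hp0 : 0 < p := one_pos.trans_le hp
  have hq0 : 0 < q := one_pos.trans hq
  have hM0' : 0 < M' := one_pos.trans_le hM'
  have hM0'' : 0 < M'' := one_pos.trans_le hM''
  set r := min p q with hr_def
  have hr : 0 < r := lt_min hp0 hq0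
  set a : ℝ := t / M'' with ha_def
  have ha : 0 < a := by positivity
  have haM : ∀ e : ℝ, a ^ (-e) = M'' ^ e * t ^ (-e) := fun e => by
    rw [ha_def, Real.div_rpow ht.le hM0''.le, Real.rpow_neg hM0''.le, div_inv_eq_mul, mul_comm]
  set D : ℝ := (M' * M'') ^ r * (1 + N ^ r) * t ^ (-r) with hD
  have hD' : D = M' ^ r * (1 + N ^ r) * a ^ (-r) := by
    rw [hD, haM, Real.mul_rpow hM0'.le hM0''.le]; ring
  have hD0 : 0 ≤ D := by positivity
  have haD : a ^ (-r) ≤ D := by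
    rw [hD']
    refine le_mul_of_one_le_left (by positivity) (one_le_mul_of_one_le_of_one_le ?_ ?_)
    · exact Real.one_le_rpow hM' hr.le
    · linarith [Real.rpow_nonneg hN r]
  have hfirst : min 1 (a ^ (-q)) ≤ D := (min_one_rpow_neg_le ha hr.le (min_le_right _ _)).trans haD
  have hpt : ∀ x, min 1 (M'' ^ q * (1 + f x ^ q) * t ^ (-q)) ≤ D + min 1 (a ^ (-q) * f x ^ q) := by
    intro x
    have : M'' ^ q * (1 + f x ^ q) * t ^ (-q) = a ^ (-q) + a ^ (-q) * f x ^ q := by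
      rw [haM]; ring
    rw [this]
    refine (min_one_add_le (by positivity) ?_).trans (by gcongr)
    exact mul_nonneg (by positivity) (Real.rpow_nonneg (hf0 x) _)
  have hB : 0 < M' ^ p * (1 + N ^ p) := by positivity
  have hsecond : ∫⁻ x, ENNReal.ofReal (min 1 (a ^ (-q) * f x ^ q)) ∂μ ≤
      ENNReal.ofReal ((1 + q / |q - p|) * D) * v := by
    rcases lt_or_gt_of_ne hpq with hlt | hgt
    · have hrp : r = p := min_eq_left hlt.le
      have hk : 0 < q - p := sub_pos.2 hlt
      have h1 : ∀ x, min 1 (a ^ (-q) * f x ^ q) ≤ a ^ (-q) * min (f x) a ^ q := by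
        intro x
        rcases le_total (f x) a with hfa | hfa
        · rw [min_eq_left hfa]; exact min_le_right _ _
        · rw [min_eq_right hfa, ← Real.rpow_add ha, neg_add_cancel, Real.rpow_zero]
          exact min_le_left _ _
      calc _ ≤ ∫⁻ x, ENNReal.ofReal (a ^ (-q)) * ENNReal.ofReal (min (f x) a ^ q) ∂μ := by
            refine lintegral_mono fun x => ?_
            rw [← ENNReal.ofReal_mul (by positivity)]
            exact ENNReal.ofReal_le_ofReal (h1 x)
        _ = ENNReal.ofReal (a ^ (-q)) * ∫⁻ x, ENNReal.ofReal (min (f x) a ^ q) ∂μ :=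
            lintegral_const_mul'' _ (by fun_prop)
        _ ≤ ENNReal.ofReal (a ^ (-q)) *
            (ENNReal.ofReal (M' ^ p * (1 + N ^ p) * a ^ (q - p) * (q / (q - p))) * v) := by
            gcongr
            exact lintegral_min_rpow_le_of_weak hf0 hf hp0 hlt hB.le h ha
        _ = ENNReal.ofReal (q / (q - p) * D) * v := by
            rw [← mul_assoc, ← ENNReal.ofReal_mul (by positivity)]
            congr 2
            have : a ^ (-p) = a ^ (-q) * a ^ (q - p) := by rw [← Real.rpow_add ha]; congr 1; ring
            rw [hD', hrp, this]; ring
        _ ≤ _ := by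
            rw [abs_of_pos hk]
            gcongr
            linarith
    · have hrq : r = q := min_eq_right hgt.le
      have hk : 0 < p - q := sub_pos.2 hgt
      calc _ ≤ ∫⁻ x, ENNReal.ofReal (a ^ (-q)) * ENNReal.ofReal (f x ^ q) ∂μ := by
            refine lintegral_mono fun x => ?_
            rw [← ENNReal.ofReal_mul (by positivity)]
            exact ENNReal.ofReal_le_ofReal (min_le_right _ _)
        _ = ENNReal.ofReal (a ^ (-q)) * ∫⁻ x, ENNReal.ofReal (f x ^ q) ∂μ :=
            lintegral_const_mul'' _ (by fun_prop)
        _ ≤ ENNReal.ofReal (a ^ (-q)) *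
            (ENNReal.ofReal ((M' ^ p * (1 + N ^ p)) ^ (q / p) * (1 + q / (p - q))) * v) := by
            gcongr
            exact lintegral_rpow_le_of_weak hf0 hf hq0 hgt hB hv h
        _ ≤ _ := by
            rw [← mul_assoc, ← ENNReal.ofReal_mul (by positivity), abs_sub_comm, abs_of_pos hk]
            gcongr ENNReal.ofReal ?_ * v
            -- Here `q / p ≤ 1`, so the power is subadditive.
            have h1 : (M' ^ p * (1 + N ^ p)) ^ (q / p) ≤ M' ^ q * (1 + N ^ q) := by
              rw [Real.mul_rpow (by positivity) (by positivity), ← Real.rpow_mul hM0'.le,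
                mul_div_cancel₀ _ hp0.ne']
              gcongr
              refine (Real.rpow_add_le_add_rpow zero_le_one (by positivity) (by positivity)
                ((div_le_one hp0).2 hgt.le)).trans (le_of_eq ?_)
              rw [Real.one_rpow, ← Real.rpow_mul hN, mul_div_cancel₀ _ hp0.ne']
            calc _ ≤ a ^ (-q) * (M' ^ q * (1 + N ^ q) * (1 + q / (p - q))) := by gcongr
              _ = _ := by rw [hD', hrq]; ring
  calc _ ≤ ∫⁻ x, (ENNReal.ofReal D + ENNReal.ofReal (min 1 (a ^ (-q) * f x ^ q))) ∂μ := by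
        refine lintegral_mono fun x => ?_
        rw [← ENNReal.ofReal_add hD0]
        · exact ENNReal.ofReal_le_ofReal (hpt x)
        · exact le_min zero_le_one (mul_nonneg (by positivity) (Real.rpow_nonneg (hf0 x) _))
    _ = ENNReal.ofReal D * μ univ + ∫⁻ x, ENNReal.ofReal (min 1 (a ^ (-q) * f x ^ q)) ∂μ := by
        rw [lintegral_add_left measurable_const, lintegral_const]
    _ ≤ ENNReal.ofReal D * v + ENNReal.ofReal ((1 + q / |q - p|) * D) * v := by gcongr
    _ = _ := by
        rw [← add_mul, ← ENNReal.ofReal_add hD0 (by positivity)]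
        congr 2; ring

/-- Weak `L^q` on a set of finite measure embeds in `L¹` for `q > 1`; the bound is linear in `1 +
N`, which keeps the patch gradients summable. -/
theorem lintegral_le_of_weak {M N : ℝ} (hq : 1 < q) (hM : 1 ≤ M) (hN : 0 ≤ N)
    (hf0 : ∀ x, 0 ≤ f x) (hf : AEMeasurable f μ) (hv : μ univ ≤ v)
    (h : ∀ t, 0 < t → μ {x | t < f x} ≤ ENNReal.ofReal (M ^ q * (1 + N ^ q) * t ^ (-q)) * v) :
    ∫⁻ x, ENNReal.ofReal (f x) ∂μ ≤ ENNReal.ofReal (M * (1 + 1 / (q - 1)) * (1 + N)) * v := by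
  have hq0 : 0 < q := one_pos.trans hq
  have hM0 : 0 < M := one_pos.trans_le hM
  have hk : 0 < q - 1 := sub_pos.2 hq
  have h1 := lintegral_rpow_le_of_weak hf0 hf one_pos hq (B := M ^ q * (1 + N ^ q))
    (by positivity) hv h
  simp only [Real.rpow_one] at h1
  refine h1.trans ?_
  gcongr ENNReal.ofReal ?_ * v
  have h2 : (M ^ q * (1 + N ^ q)) ^ (1 / q) ≤ M * (1 + N) := by
    rw [Real.mul_rpow (by positivity) (by positivity), ← Real.rpow_mul hM0.le,
      mul_one_div_cancel hq0.ne', Real.rpow_one]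
    gcongr
    refine (Real.rpow_add_le_add_rpow zero_le_one (by positivity) (by positivity)
      ((div_le_one hq0).2 hq.le)).trans (le_of_eq ?_)
    rw [Real.one_rpow, ← Real.rpow_mul hN, mul_one_div_cancel hq0.ne', Real.rpow_one]
  calc _ ≤ M * (1 + N) * (1 + 1 / (q - 1)) := by gcongr
    _ = _ := by ring

end WeakLp

end WeakReduction

namespace WeakReduction

open Filter Topology Metric

variable {d m : ℕ}

/-! ### Decomposition of a piecewise affine map into balls -/

section Decomposition

/-- Besicovitch's theorem supplies disjoint closed balls; passing to open balls loses countably many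
null spheres. -/
theorem exists_disjoint_balls_covering_ae {U : Set (E m)} (hU : IsOpen U) {R : ℝ} (hR : 0 < R) :
    ∃ (t : Set (E m)) (r : E m → ℝ), t.Countable ∧
      (∀ x ∈ t, 0 < r x ∧ r x < R ∧ ball x (r x) ⊆ U) ∧
      t.PairwiseDisjoint (fun x => ball x (r x)) ∧
      volume (U \ ⋃ x ∈ t, ball x (r x)) = 0 := by
  obtain ⟨t, r, htc, -, hr, hcov, hdisj⟩ := Besicovitch.exists_disjoint_closedBall_covering_ae
    (volume : Measure (E m)) (fun x => {ρ | closedBall x ρ ⊆ U}) U (fun x hx δ hδ => by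
      obtain ⟨ρ, hρ, hρU⟩ := Metric.nhds_basis_closedBall.mem_iff.1 (hU.mem_nhds hx)
      refine ⟨min ρ (δ / 2), ?_, lt_min hρ (half_pos hδ), ?_⟩
      · exact (closedBall_subset_closedBall (min_le_left _ _)).trans hρU
      · exact (min_le_right _ _).trans_lt (half_lt_self hδ)) (fun _ => R) fun _ _ => hR
  refine ⟨t, r, htc, fun x hx => ⟨(hr x hx).2.1, (hr x hx).2.2,
    ball_subset_closedBall.trans (hr x hx).1⟩, fun x hx y hy hxy =>
    (hdisj hx hy hxy).mono ball_subset_closedBall ball_subset_closedBall, ?_⟩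
  have hs : volume (⋃ x ∈ t, sphere x (r x)) = 0 := by
    rw [measure_biUnion_null_iff htc]
    exact fun x hx => Measure.addHaar_sphere_of_ne_zero _ _ (hr x hx).2.1.ne'
  refine measure_mono_null ?_ (measure_union_null hcov hs)
  rintro x ⟨hxU, hxb⟩
  by_cases hx : x ∈ ⋃ y ∈ t, closedBall y (r y)
  · refine Or.inr ?_
    simp only [mem_iUnion, exists_prop, not_exists, not_and] at hx hxb ⊢
    obtain ⟨y, hy, hxy⟩ := hx
    refine ⟨y, hy, le_antisymm hxy (not_lt.1 fun h => hxb y hy h)⟩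
  · exact Or.inl ⟨hxU, hx⟩

/-- A decomposition of `Ω`, up to a null set, into balls on which `u` is affine with gradient in `K`
and regular domains on which `u` is affine with gradient outside `K`. -/
structure IsBallDecomposition (K : Set (Mat d m)) (Ω : Set (E m)) (u : E m → E d) {ι : Type*}
    (c : ι → E m) (r : ι → ℝ) (A : ι → Mat d m) (Q : Set (Set (E m))) : Prop where
  radius_pos : ∀ k, 0 < r k
  mem : ∀ k, A k ∈ K
  ball_subset : ∀ k, ball (c k) (r k) ⊆ Ω
  disjoint_ball : Pairwise fun k l => Disjoint (ball (c k) (r k)) (ball (c l) (r l))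
  eqOn : ∀ k, ∃ b, EqOn u (affineMap (A k) b) (ball (c k) (r k))
  countable : Q.Countable
  pairwiseDisjoint : Q.PairwiseDisjoint id
  piece : ∀ U ∈ Q, IsRegularDomain U ∧ U ⊆ Ω ∧ ∃ B ∉ K, ∃ b, EqOn u (affineMap B b) U
  disjoint_piece : ∀ k, ∀ U ∈ Q, Disjoint (ball (c k) (r k)) U
  null : volume (Ω \ ((⋃ k, ball (c k) (r k)) ∪ ⋃₀ Q)) = 0

/-- The radius bound may depend on the gradient because the covering is done separately on each good
piece. -/
theorem IsPiecewiseAffine.exists_isBallDecomposition {Ω : Set (E m)} {u : E m → E d}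
    (hu : IsPiecewiseAffine Ω u) (K : Set (Mat d m)) (R : Mat d m → ℝ) (hR : ∀ A ∈ K, 0 < R A) :
    ∃ (ι : Type) (_ : Countable ι) (c : ι → E m) (r : ι → ℝ) (A : ι → Mat d m)
      (Q : Set (Set (E m))), IsBallDecomposition K Ω u c r A Q ∧ ∀ k, r k < R (A k) := by
  obtain ⟨P, hPc, hPd, hP, hPv⟩ := hu
  have hP' : ∀ U ∈ P, ∃ A : Mat d m, ∃ b : E d, EqOn u (affineMap A b) U := fun U hU => (hP U hU).2.2
  choose! A b hA using hP'
  let good : Set (Set (E m)) := {U ∈ P | A U ∈ K}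
  have hball : ∀ U ∈ good, ∃ (t : Set (E m)) (r : E m → ℝ), t.Countable ∧
      (∀ x ∈ t, 0 < r x ∧ r x < R (A U) ∧ ball x (r x) ⊆ U) ∧
      t.PairwiseDisjoint (fun x => ball x (r x)) ∧
      volume (U \ ⋃ x ∈ t, ball x (r x)) = 0 := fun U hU =>
    exists_disjoint_balls_covering_ae (hP U hU.1).1.isOpen (hR _ hU.2)
  choose! t r htc ht htd htv using hball
  have hgc : good.Countable := hPc.mono (sep_subset _ _)
  have : Countable good := hgc.to_subtype
  have : ∀ U : good, Countable (t U) := fun U => (htc U U.2).to_subtype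
  refine ⟨Σ U : good, t U, inferInstance, fun k => k.2, fun k => r k.1 k.2, fun k => A k.1,
    {U ∈ P | A U ∉ K}, ⟨?_, ?_, ?_, ?_, ?_, ?_, ?_, ?_, ?_, ?_⟩, ?_⟩
  · exact fun k => (ht k.1 k.1.2 k.2 k.2.2).1
  · exact fun k => k.1.2.2
  · exact fun k => (ht k.1 k.1.2 k.2 k.2.2).2.2.trans (hP k.1 k.1.2.1).2.1
  · rintro ⟨⟨U, hU⟩, ⟨x, hx⟩⟩ ⟨⟨U', hU'⟩, ⟨y, hy⟩⟩ hne
    by_cases hUU : U = U'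
    · subst hUU
      exact htd U hU hx hy fun h => hne (by subst h; rfl)
    · exact (hPd hU.1 hU'.1 hUU).mono (ht U hU x hx).2.2 (ht U' hU' y hy).2.2
  · exact fun k => ⟨b k.1, (hA k.1 k.1.2.1).mono (ht k.1 k.1.2 k.2 k.2.2).2.2⟩
  · exact hPc.mono (sep_subset _ _)
  · exact hPd.subset (sep_subset _ _)
  · exact fun U hU => ⟨(hP U hU.1).1, (hP U hU.1).2.1, A U, hU.2, b U, hA U hU.1⟩
  · rintro ⟨⟨U, hU⟩, ⟨x, hx⟩⟩ U' hU'
    refine Disjoint.mono_left (ht U hU x hx).2.2 (hPd hU.1 hU'.1 ?_)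
    rintro rfl
    exact hU'.2 hU.2
  · have hn : volume (⋃ U ∈ good, U \ ⋃ x ∈ t U, ball x (r U x)) = 0 :=
      (measure_biUnion_null_iff hgc).2 fun U hU => htv U hU
    refine measure_mono_null ?_ (measure_union_null hPv hn)
    rintro x ⟨hxΩ, hx⟩
    rw [mem_union, not_or] at hx
    by_cases hxP : x ∈ ⋃₀ P
    · obtain ⟨U, hU, hxU⟩ := hxP
      have hUg : A U ∈ K := by
        by_contra h
        exact hx.2 ⟨U, ⟨hU, h⟩, hxU⟩
      refine Or.inr (mem_biUnion (show U ∈ good from ⟨hU, hUg⟩) ⟨hxU, fun hxb => hx.1 ?_⟩)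
      obtain ⟨y, hy, hxy⟩ := mem_iUnion₂.1 hxb
      exact mem_iUnion.2 ⟨⟨⟨U, hU, hUg⟩, ⟨y, hy⟩⟩, hxy⟩
    · exact Or.inl ⟨hxΩ, hxP⟩
  · exact fun k => (ht k.1 k.1.2 k.2 k.2.2).2.1

namespace IsBallDecomposition

variable {K : Set (Mat d m)} {Ω : Set (E m)} {u : E m → E d} {G : E m → Mat d m} {ι : Type*}
  {c : ι → E m} {r : ι → ℝ} {A : ι → Mat d m} {Q : Set (Set (E m))}

theorem grad_ae_eq [Countable ι] (h : IsBallDecomposition K Ω u c r A Q) (hw : IsW11WithGradient Ω u G) :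
    ∀ᵐ x, ∀ k, x ∈ ball (c k) (r k) → G x = A k := by
  refine ae_all_iff.2 fun k => ?_
  obtain ⟨b, hb⟩ := h.eqOn k
  exact hw.ae_eq_of_eqOn_affineMap isOpen_ball isBounded_ball (h.ball_subset k) hb

theorem grad_ae_notMem (h : IsBallDecomposition K Ω u c r A Q) (hw : IsW11WithGradient Ω u G) :
    ∀ᵐ x, x ∈ ⋃₀ Q → G x ∉ K := by
  have key : ∀ U ∈ Q, ∀ᵐ x, x ∈ U → G x ∉ K := by
    intro U hU
    obtain ⟨h1, h2, B, hB, b, hb⟩ := h.piece U hU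
    filter_upwards [hw.ae_eq_of_eqOn_affineMap h1.isOpen h1.isBounded h2 hb] with x hx hxU
    rw [hx hxU]; exact hB
  filter_upwards [(ae_ball_iff h.countable).2 key] with x hx hxQ
  obtain ⟨U, hU, hxU⟩ := hxQ
  exact hx U hU hxU

theorem isOpen_sUnion (h : IsBallDecomposition K Ω u c r A Q) : IsOpen (⋃₀ Q) :=
  _root_.isOpen_sUnion fun U hU => (h.piece U hU).1.isOpen

theorem sUnion_subset (h : IsBallDecomposition K Ω u c r A Q) : ⋃₀ Q ⊆ Ω :=
  Set.sUnion_subset fun U hU => (h.piece U hU).2.1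

theorem notMem_ball (h : IsBallDecomposition K Ω u c r A Q) {x : E m} (hx : x ∈ ⋃₀ Q) (k : ι) :
    x ∉ ball (c k) (r k) := by
  obtain ⟨U, hU, hxU⟩ := hx
  exact fun hk => disjoint_left.1 (h.disjoint_piece k U hU) hk hxU

/-- Since `G = A k` a.e. on the disjoint balls, the sum is an integral over their union. This turns
every sum over patches into an integral of `G` over `Ω`. -/
theorem tsum_mul_volume_le [Countable ι] (h : IsBallDecomposition K Ω u c r A Q)
    (hw : IsW11WithGradient Ω u G) (F : Mat d m → ℝ≥0∞) :
    ∑' k, F (A k) * volume (ball (c k) (r k)) ≤ ∫⁻ x in Ω, F (G x) := by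
  calc _ = ∑' k, ∫⁻ x in ball (c k) (r k), F (G x) := by
        congr 1; ext k
        rw [← setLIntegral_const]
        refine setLIntegral_congr_fun_ae measurableSet_ball ?_
        filter_upwards [h.grad_ae_eq hw] with x hx hxk
        rw [hx k hxk]
    _ = ∫⁻ x in ⋃ k, ball (c k) (r k), F (G x) :=
        (lintegral_iUnion (fun k => measurableSet_ball) h.disjoint_ball _).symm
    _ ≤ _ := lintegral_mono_set (iUnion_subset h.ball_subset)

/-- Values at `x` of a family of functions supported in the balls of a decomposition. -/
theorem tsum_eq_of_mem_ball {F : Type*} [AddCommMonoid F] [TopologicalSpace F]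
    (h : IsBallDecomposition K Ω u c r A Q) {f : ι → E m → F}
    (hf : ∀ k, ∀ x ∉ ball (c k) (r k), f k x = 0) {k : ι} {x : E m} (hx : x ∈ ball (c k) (r k)) :
    ∑' l, f l x = f k x :=
  tsum_eq_single k fun l hl => hf l x fun hxl => disjoint_left.1 (h.disjoint_ball hl) hxl hx

theorem summable {F : Type*} [AddCommMonoid F] [TopologicalSpace F]
    (h : IsBallDecomposition K Ω u c r A Q) {f : ι → E m → F}
    (hf : ∀ k, ∀ x ∉ ball (c k) (r k), f k x = 0) (x : E m) : Summable fun k => f k x := by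
  by_cases hx : ∃ k, x ∈ ball (c k) (r k)
  · obtain ⟨k, hk⟩ := hx
    refine summable_of_ne_finset_zero (s := {k}) fun l hl => hf l x fun hxl => ?_
    exact disjoint_left.1 (h.disjoint_ball fun e => hl (by simp [e])) hxl hk
  · exact summable_of_ne_finset_zero (s := ∅) fun l _ => hf l x (not_exists.1 hx l)

theorem holderWith_tsum {α H : ℝ≥0} {W : ι → E m → E d}
    (h : IsBallDecomposition K Ω u c r A Q) (hW : ∀ k, HolderWith H α (W k)) (hW0 : ∀ k, ∀ x ∉ ball (c k) (r k), W k x = 0) :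
    HolderWith (2 * H) α fun x => ∑' k, W k x := by
  refine holderWith_of_disjoint_support hW hW0 h.disjoint_ball
    (fun k x hx => h.tsum_eq_of_mem_ball hW0 hx) fun x hx => ?_
  simp only [fun k => hW0 k x (hx k), tsum_zero]

theorem setLIntegral_sUnion_le (h : IsBallDecomposition K Ω u c r A Q)
    (hw : IsW11WithGradient Ω u G) (F : Mat d m → ℝ≥0∞) :
    ∫⁻ x in ⋃₀ Q, F (G x) ≤ ∫⁻ x in {x ∈ Ω | G x ∉ K}, F (G x) := by
  refine lintegral_mono_set' ?_
  filter_upwards [h.grad_ae_notMem hw] with x hx hxQ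
  exact ⟨h.sUnion_subset hxQ, hx hxQ⟩

/-- Chebyshev's inequality: where `matNorm (G x) > t`, one has `t ^ e ≤ (1 + matNorm (G x)) ^ s`,
the 1 making the larger exponent harmless. -/
theorem volume_sUnion_lt_le (h : IsBallDecomposition K Ω u c r A Q)
    (hw : IsW11WithGradient Ω u G) {e s : ℝ} (he : 0 ≤ e) (hes : e ≤ s)
    (herr : ∫⁻ x in {x ∈ Ω | G x ∉ K}, ENNReal.ofReal ((1 + matNorm (G x)) ^ s) ≤ volume Ω)
    {t : ℝ} (ht : 0 < t) :
    volume {x ∈ ⋃₀ Q | t < matNorm (G x)} ≤ ENNReal.ofReal (t ^ (-e)) * volume Ω := by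
  have hmeas : AEMeasurable (fun x => matNorm (G x)) (volume.restrict (⋃₀ Q)) :=
    aemeasurable_matNorm fun i j =>
      ((hw.integrableOn_grad i j).mono_set h.sUnion_subset).aemeasurable
  have h1 := mul_meas_ge_le_lintegral₀ (μ := volume.restrict (⋃₀ Q))
    (f := fun x => ENNReal.ofReal ((1 + matNorm (G x)) ^ s)) (by fun_prop) (ENNReal.ofReal (t ^ e))
  have h2 : volume {x ∈ ⋃₀ Q | t < matNorm (G x)} ≤ volume.restrict (⋃₀ Q)
      {x | ENNReal.ofReal (t ^ e) ≤ ENNReal.ofReal ((1 + matNorm (G x)) ^ s)} := by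
    rw [Measure.restrict_apply' h.isOpen_sUnion.measurableSet]
    refine measure_mono fun x hx => ⟨ENNReal.ofReal_le_ofReal ?_, hx.1⟩
    have hx2 : t < matNorm (G x) := hx.2
    calc t ^ e ≤ (1 + matNorm (G x)) ^ e := Real.rpow_le_rpow ht.le (by linarith) he
      _ ≤ _ := Real.rpow_le_rpow_of_exponent_le (by linarith) hes
  have h3 : ENNReal.ofReal (t ^ (-e)) * ENNReal.ofReal (t ^ e) = 1 := by
    rw [← ENNReal.ofReal_mul (by positivity), ← Real.rpow_add ht]; simp
  calc _ = ENNReal.ofReal (t ^ (-e)) * (ENNReal.ofReal (t ^ e) *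
        volume {x ∈ ⋃₀ Q | t < matNorm (G x)}) := by rw [← mul_assoc, h3, one_mul]
    _ ≤ _ := by
      gcongr
      calc _ ≤ _ := mul_le_mul_right h2 _
        _ ≤ _ := h1
        _ ≤ _ := h.setLIntegral_sUnion_le hw fun B => ENNReal.ofReal ((1 + matNorm B) ^ s)
        _ ≤ _ := herr

end IsBallDecomposition

end Decomposition

/-! ### Gluing the patches -/

section Gluing

/-- The weak bound concerns `A + g`; its `L¹` norm on the ball is estimated first, and subtracting
`A` accounts for the extra `+ 1`. -/
theorem IsPatch.lintegral_enorm_grad_le {K : Set (Mat d m)} {A : Mat d m} {q M ε s : ℝ} {α H : ℝ≥0}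
    {B : ℝ} {c : E m} {r : ℝ} {W : E m → E d} {g : E m → Mat d m} (hq : 1 < q) (hM : 1 ≤ M)
    (h : IsPatch K A q (M ^ q) ε s α H B c r W g) (i : Fin d) (j : Fin m) :
    ∫⁻ x, ‖g x i j‖ₑ ≤
      ENNReal.ofReal ((M * (1 + 1 / (q - 1)) + 1) * (1 + matNorm A)) * volume (ball c r) := by
  have hk : 0 < q - 1 := sub_pos.2 hq
  have hM0 : 0 < M := one_pos.trans_le hM
  have hN := matNorm_nonneg A
  have hmeas : AEMeasurable (fun x => matNorm (A + g x)) (volume.restrict (ball c r)) := by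
    refine aemeasurable_matNorm fun i j => ?_
    have := ((integrableOn_univ.1 (h.w11.integrableOn_grad i j)).aemeasurable).restrict
      (s := ball c r)
    exact aemeasurable_const.add this
  have h1 := lintegral_le_of_weak (μ := volume.restrict (ball c r)) (v := volume (ball c r)) hq hM hN
    (fun x => matNorm_nonneg (A + g x)) hmeas (by simp) (fun t ht => by
      rw [Measure.restrict_apply' measurableSet_ball, inter_comm]
      exact h.distrib_le t ht)
  have hsupp : ∫⁻ x, ‖g x i j‖ₑ = ∫⁻ x in ball c r, ‖g x i j‖ₑ := by
    rw [← lintegral_indicator measurableSet_ball]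
    congr 1; ext x
    by_cases hx : x ∈ ball c r
    · rw [indicator_of_mem hx]
    · rw [indicator_of_notMem hx, h.grad_eq_zero x hx]; simp
  calc _ ≤ ∫⁻ x in ball c r, (ENNReal.ofReal (matNorm (A + g x)) + ENNReal.ofReal (matNorm A)) := by
        rw [hsupp]
        refine lintegral_mono fun x => ?_
        rw [← ENNReal.ofReal_add (matNorm_nonneg _) hN, ← ofReal_norm, Real.norm_eq_abs]
        refine ENNReal.ofReal_le_ofReal ?_
        have e1 := abs_apply_le_matNorm (A + g x) i j
        have e2 := abs_apply_le_matNorm A i j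
        have e3 := abs_sub (A i j + g x i j) (A i j)
        rw [add_sub_cancel_left] at e3
        rw [Matrix.add_apply] at e1
        linarith
    _ = (∫⁻ x in ball c r, ENNReal.ofReal (matNorm (A + g x))) +
        ENNReal.ofReal (matNorm A) * volume (ball c r) := by
        rw [lintegral_add_right _ measurable_const, setLIntegral_const]
    _ ≤ ENNReal.ofReal (M * (1 + 1 / (q - 1)) * (1 + matNorm A)) * volume (ball c r) +
        ENNReal.ofReal (1 + matNorm A) * volume (ball c r) := by
        gcongr
        linarith
    _ = _ := by
        rw [← add_mul, ← ENNReal.ofReal_add (by positivity) (by positivity)]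
        congr 2; ring

namespace IsBallDecomposition

variable {K K' : Set (Mat d m)} {Ω : Set (E m)} {u : E m → E d} {G : E m → Mat d m} {ι : Type*}
  [Countable ι] {c : ι → E m} {r : ι → ℝ} {A : ι → Mat d m} {Q : Set (Set (E m))}
  {q M ε s : ℝ} {α : ℝ≥0} {W : ι → E m → E d} {g : ι → E m → Mat d m}

theorem isW11WithGradient_tsum (h : IsBallDecomposition K Ω u c r A Q) (hΩ : IsRegularDomain Ω)
    (hw : IsW11WithGradient Ω u G) (hq : 1 < q) (hM : 1 ≤ M)
    (hp : ∀ k, IsPatch K' (A k) q (M ^ q) ε s α 1 1 (c k) (r k) (W k) (g k)) :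
    IsW11WithGradient univ (fun x => ∑' k, W k x)
      (fun x => Matrix.of fun i j => ∑' k, g k x i j) := by
  refine WeakReduction.isW11WithGradient_tsum (fun k => (hp k).w11)
    (h.summable fun k => (hp k).eq_zero) ?_ fun i j => ?_
  · refine ne_top_of_le_ne_top hΩ.isBounded.measure_lt_top.ne
      (b := volume Ω) (le_trans (ENNReal.tsum_le_tsum fun k => ?_)
        ((h.tsum_mul_volume_le hw fun _ => 1).trans_eq (by simp)))
    rw [one_mul, ← lintegral_indicator_one measurableSet_ball]
    refine lintegral_mono fun x => ?_
    by_cases hx : x ∈ ball (c k) (r k)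
    · rw [indicator_of_mem hx, ← ofReal_norm, Pi.one_apply, ENNReal.ofReal_le_one]
      exact (hp k).norm_le x
    · rw [(hp k).eq_zero x hx]; simp
  · refine ne_top_of_le_ne_top ?_ (le_trans
      (ENNReal.tsum_le_tsum fun k => (hp k).lintegral_enorm_grad_le hq hM i j)
      (h.tsum_mul_volume_le hw fun B =>
        ENNReal.ofReal ((M * (1 + 1 / (q - 1)) + 1) * (1 + matNorm B))))
    have hint : IntegrableOn (fun x => (M * (1 + 1 / (q - 1)) + 1) * (1 + matNorm (G x))) Ω :=
      ((integrableOn_const hΩ.isBounded.measure_lt_top.ne).add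
        (integrable_matNorm hw.integrableOn_grad)).const_mul _
    exact hint.lintegral_lt_top.ne

theorem isPiecewiseAffine_add_tsum (h : IsBallDecomposition K Ω u c r A Q)
    (hW : ∀ k, ∀ x ∉ ball (c k) (r k), W k x = 0)
    (hp : ∀ k, IsPiecewiseAffine (ball (c k) (r k)) (W k)) :
    IsPiecewiseAffine Ω fun x => u x + ∑' k, W k x := by
  choose P hPc hPd hP hPv using hp
  have hsub : ∀ k, ∀ U ∈ P k, U ⊆ ball (c k) (r k) := fun k U hU => (hP k U hU).2.1
  refine ⟨Q ∪ ⋃ k, P k, h.countable.union (countable_iUnion hPc), ?_, ?_, ?_⟩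
  · rintro U (hU | hU) U' (hU' | hU') hne
    · exact h.pairwiseDisjoint hU hU' hne
    · obtain ⟨k, hk⟩ := mem_iUnion.1 hU'
      exact ((h.disjoint_piece k U hU).mono_left (hsub k U' hk)).symm
    · obtain ⟨k, hk⟩ := mem_iUnion.1 hU
      exact (h.disjoint_piece k U' hU').mono_left (hsub k U hk)
    · obtain ⟨k, hk⟩ := mem_iUnion.1 hU
      obtain ⟨l, hl⟩ := mem_iUnion.1 hU'
      by_cases hkl : k = l
      · subst hkl; exact hPd k hk hl hne
      · exact (h.disjoint_ball hkl).mono (hsub k U hk) (hsub l U' hl)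
  · rintro U (hU | hU)
    · obtain ⟨h1, h2, B, -, b, hb⟩ := h.piece U hU
      refine ⟨h1, h2, B, b, fun x hx => ?_⟩
      have : ∀ k, W k x = 0 := fun k => hW k x (h.notMem_ball ⟨U, hU, hx⟩ k)
      simp only [this, tsum_zero, add_zero]
      exact hb hx
    · obtain ⟨k, hk⟩ := mem_iUnion.1 hU
      obtain ⟨h1, h2, B, b, hb⟩ := hP k U hk
      obtain ⟨b', hb'⟩ := h.eqOn k
      refine ⟨h1, h2.trans (h.ball_subset k), A k + B, b' + b, fun x hx => ?_⟩
      simp only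
      rw [h.tsum_eq_of_mem_ball hW (h2 hx), hb hx, hb' (h2 hx), affineMap_add_affineMap]
  · refine measure_mono_null ?_ (measure_union_null h.null (measure_iUnion_null hPv))
    rintro x ⟨hxΩ, hx⟩
    rw [sUnion_union, mem_union, not_or] at hx
    by_cases hxb : ∃ k, x ∈ ball (c k) (r k)
    · obtain ⟨k, hk⟩ := hxb
      refine Or.inr (mem_iUnion.2 ⟨k, hk, fun hxP => hx.2 ?_⟩)
      obtain ⟨U, hU, hxU⟩ := hxP
      exact ⟨U, mem_iUnion.2 ⟨k, hU⟩, hxU⟩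
    · refine Or.inl ⟨hxΩ, ?_⟩
      rintro (h' | h')
      · exact hxb (mem_iUnion.1 h')
      · exact hx.1 h'

/-- The glued gradient is `A k + g k` a.e. on the `k`-th ball and `G` on the untouched pieces.
General `F` and `T` serve both estimates: the error integral (`T = K'ᶜ`) and the distribution
function (`F = 1`). -/
theorem setLIntegral_add_tsum_le (h : IsBallDecomposition K Ω u c r A Q)
    (hw : IsW11WithGradient Ω u G) (hg : ∀ k, ∀ x ∉ ball (c k) (r k), g k x = 0)
    (F : Mat d m → ℝ≥0∞) (T : Set (Mat d m)) :
    ∫⁻ x in {x ∈ Ω | G x + Matrix.of (fun i j => ∑' k, g k x i j) ∈ T},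
        F (G x + Matrix.of fun i j => ∑' k, g k x i j) ≤
      (∑' k, ∫⁻ x in {x ∈ ball (c k) (r k) | A k + g k x ∈ T}, F (A k + g k x)) +
        ∫⁻ x in {x ∈ ⋃₀ Q | G x ∈ T}, F (G x) := by
  set Z : E m → Mat d m := fun x => G x + Matrix.of fun i j => ∑' k, g k x i j with hZ
  have hball : ∀ᵐ x, ∀ k, x ∈ ball (c k) (r k) → Z x = A k + g k x := by
    filter_upwards [h.grad_ae_eq hw] with x hx k hk
    rw [← hx k hk]
    refine congrArg (G x + ·) ?_
    ext i j
    rw [Matrix.of_apply]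
    exact h.tsum_eq_of_mem_ball (f := fun l y => g l y i j)
      (fun l y hy => by simp only [hg l y hy, Matrix.zero_apply]) hk
  have hQ : ∀ x ∈ ⋃₀ Q, Z x = G x := by
    intro x hx
    have : ∀ k, g k x = 0 := fun k => hg k x (h.notMem_ball hx k)
    simp only [hZ, this, Matrix.zero_apply, tsum_zero]
    ext i j
    simp
  have hset : {x ∈ Ω | Z x ∈ T} ≤ᵐ[volume]
      ((⋃ k, {x ∈ ball (c k) (r k) | A k + g k x ∈ T}) ∪ {x ∈ ⋃₀ Q | G x ∈ T} : Set (E m)) := by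
    have hnull : ∀ᵐ x, x ∉ Ω \ ((⋃ k, ball (c k) (r k)) ∪ ⋃₀ Q) := measure_eq_zero_iff_ae_notMem.1 h.null
    filter_upwards [hball, hnull] with x hx hxn hxS
    obtain ⟨hxΩ, hxT⟩ : x ∈ Ω ∧ Z x ∈ T := hxS
    have hxU : x ∈ (⋃ k, ball (c k) (r k)) ∪ ⋃₀ Q := by
      by_contra h'; exact hxn ⟨hxΩ, h'⟩
    rcases hxU with hxU | hxU
    · obtain ⟨k, hk⟩ := mem_iUnion.1 hxU
      exact Or.inl (mem_iUnion.2 ⟨k, hk, by rwa [← hx k hk]⟩)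
    · exact Or.inr ⟨hxU, by rwa [← hQ x hxU]⟩
  refine (lintegral_mono_set' hset).trans ((lintegral_union_le _ _ _).trans ?_)
  refine add_le_add ((lintegral_iUnion_le _ _).trans (ENNReal.tsum_le_tsum fun k => ?_)) ?_
  · refine le_of_eq (lintegral_congr_ae ?_)
    refine ae_restrict_of_ae_restrict_of_subset (sep_subset _ _) ?_
    rw [ae_restrict_iff' measurableSet_ball]
    filter_upwards [hball] with x hx hxk
    exact congrArg F (hx k hxk)
  · refine le_of_eq (lintegral_congr_ae ?_)
    refine ae_restrict_of_ae_restrict_of_subset (sep_subset _ _) ?_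
    rw [ae_restrict_iff' h.isOpen_sUnion.measurableSet]
    exact Eventually.of_forall fun x hx => congrArg F (hQ x hx)

end IsBallDecomposition

end Gluing

end WeakReduction

namespace WeakReduction

open Filter Topology Metric

variable {d m : ℕ}

/-! ### Estimates for the glued map and conclusion -/

namespace IsBallDecomposition

variable {K K' : Set (Mat d m)} {Ω : Set (E m)} {u : E m → E d} {G : E m → Mat d m} {ι : Type*}
  [Countable ι] {c : ι → E m} {r : ι → ℝ} {A : ι → Mat d m} {Q : Set (Set (E m))}
  {p q M M' N ε δ s s' : ℝ} {α : ℝ≥0} {W : ι → E m → E d} {g : ι → E m → Mat d m}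

/-- The patches contribute at most `δ * |Ω|`, which is finite, so the strict inequality of the first
stage survives the addition. -/
theorem error_lt (h : IsBallDecomposition K Ω u c r A Q) (hΩ : IsRegularDomain Ω)
    (hw : IsW11WithGradient Ω u G) (hδ : 0 ≤ δ) (hε : 0 ≤ ε) (hss' : s ≤ s')
    (hp : ∀ k, IsPatch K' (A k) q M δ s α 1 1 (c k) (r k) (W k) (g k))
    (herr : ∫⁻ x in {x ∈ Ω | G x ∉ K}, ENNReal.ofReal ((1 + matNorm (G x)) ^ s')
      < ENNReal.ofReal ε * volume Ω) :
    ∫⁻ x in {x ∈ Ω | G x + Matrix.of (fun i j => ∑' k, g k x i j) ∉ K'},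
        ENNReal.ofReal ((1 + matNorm (G x + Matrix.of fun i j => ∑' k, g k x i j)) ^ s) <
      ENNReal.ofReal (δ + ε) * volume Ω := by
  have h1 := h.setLIntegral_add_tsum_le hw (fun k => (hp k).grad_eq_zero)
    (fun B => ENNReal.ofReal ((1 + matNorm B) ^ s)) K'ᶜ
  refine h1.trans_lt ?_
  rw [ENNReal.ofReal_add hδ hε, add_mul]
  have hsum : (∑' k, ∫⁻ x in {x ∈ ball (c k) (r k) | A k + g k x ∈ K'ᶜ},
      ENNReal.ofReal ((1 + matNorm (A k + g k x)) ^ s)) ≤ ENNReal.ofReal δ * volume Ω := by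
    refine (ENNReal.tsum_le_tsum fun k => (hp k).error_le).trans ?_
    exact (h.tsum_mul_volume_le hw fun _ => ENNReal.ofReal δ).trans_eq (setLIntegral_const _ _)
  refine ENNReal.add_lt_add_of_le_of_lt (ne_top_of_le_ne_top
    (ENNReal.mul_ne_top ENNReal.ofReal_ne_top hΩ.isBounded.measure_lt_top.ne) hsum) hsum
    (lt_of_le_of_lt ?_ herr)
  calc _ ≤ ∫⁻ x in ⋃₀ Q, ENNReal.ofReal ((1 + matNorm (G x)) ^ s) :=
        lintegral_mono_set (sep_subset _ _)
    _ ≤ ∫⁻ x in {x ∈ Ω | G x ∉ K}, ENNReal.ofReal ((1 + matNorm (G x)) ^ s) :=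
        h.setLIntegral_sUnion_le hw fun B => ENNReal.ofReal ((1 + matNorm B) ^ s)
    _ ≤ _ := by
        refine lintegral_mono fun x => ENNReal.ofReal_le_ofReal ?_
        exact Real.rpow_le_rpow_of_exponent_le (by linarith [matNorm_nonneg (G x)]) hss'

theorem volume_lt_matNorm_le (h : IsBallDecomposition K Ω u c r A Q) (hΩ : IsRegularDomain Ω)
    (hw : IsW11WithGradient Ω u G) (hp1 : 1 ≤ p) (hq : 1 < q) (hpq : p ≠ q) (hM' : 1 ≤ M')
    (hM : 1 ≤ M) (hN : 0 ≤ N)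
    (hp : ∀ k, IsPatch K' (A k) q (M ^ q) δ s α 1 1 (c k) (r k) (W k) (g k))
    (hs' : min p q ≤ s')
    (herr : ∫⁻ x in {x ∈ Ω | G x ∉ K}, ENNReal.ofReal ((1 + matNorm (G x)) ^ s') ≤ volume Ω)
    (hdist : ∀ t : ℝ, 0 < t → volume {x ∈ Ω | t < matNorm (G x)} ≤
      ENNReal.ofReal (M' ^ p * (1 + N ^ p) * t ^ (-p)) * volume Ω) {t : ℝ} (ht : 0 < t) :
    volume {x ∈ Ω | t < matNorm (G x + Matrix.of fun i j => ∑' k, g k x i j)} ≤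
      ENNReal.ofReal (4 * (1 + q / |q - p|) * (M' * M) ^ (min p q) * (1 + N ^ (min p q)) *
        t ^ (-(min p q))) * volume Ω := by
  have hp0 : 0 < p := one_pos.trans_le hp1
  have hq0 : 0 < q := one_pos.trans hq
  have hM0' : 0 < M' := one_pos.trans_le hM'
  have hM0 : 0 < M := one_pos.trans_le hM
  have he : 0 < min p q := lt_min hp0 hq0
  set D : ℝ := (M' * M) ^ (min p q) * (1 + N ^ (min p q)) * t ^ (-(min p q)) with hD
  have hD0 : 0 ≤ D := by positivity
  have h1 := h.setLIntegral_add_tsum_le hw (fun k => (hp k).grad_eq_zero) (fun _ => 1)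
    {B | t < matNorm B}
  simp only [setLIntegral_one] at h1
  have hmeas : AEMeasurable (fun x => matNorm (G x)) (volume.restrict Ω) :=
    aemeasurable_matNorm fun i j => (hw.integrableOn_grad i j).aemeasurable
  have hsum : (∑' k, volume {x ∈ ball (c k) (r k) | t < matNorm (A k + g k x)}) ≤
      ENNReal.ofReal ((2 + q / |q - p|) * D) * volume Ω := by
    -- The trivial bound by the whole ball cannot be dropped: for `p < q` the weak `L^p` bound does
    -- not make `matNorm (G x) ^ q` integrable.
    calc _ ≤ ∑' k, ENNReal.ofReal (min 1 (M ^ q * (1 + matNorm (A k) ^ q) * t ^ (-q))) *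
          volume (ball (c k) (r k)) := by
          refine ENNReal.tsum_le_tsum fun k => ?_
          rcases min_cases (1 : ℝ) (M ^ q * (1 + matNorm (A k) ^ q) * t ^ (-q)) with h' | h'
          · rw [h'.1, ENNReal.ofReal_one, one_mul]
            exact measure_mono (sep_subset _ _)
          · rw [h'.1]
            exact (hp k).distrib_le t ht
      _ ≤ ∫⁻ x in Ω, ENNReal.ofReal (min 1 (M ^ q * (1 + matNorm (G x) ^ q) * t ^ (-q))) :=
          h.tsum_mul_volume_le hw fun B =>
            ENNReal.ofReal (min 1 (M ^ q * (1 + matNorm B ^ q) * t ^ (-q)))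
      _ ≤ _ := lintegral_min_one_le_of_weak hp1 hq hpq hM' hM hN (fun x => matNorm_nonneg _) hmeas
          (by simp) (fun t ht => by
            rw [Measure.restrict_apply' hΩ.isOpen.measurableSet, inter_comm]
            exact hdist t ht) ht
  have hbad : volume {x ∈ ⋃₀ Q | t < matNorm (G x)} ≤ ENNReal.ofReal D * volume Ω := by
    refine (h.volume_sUnion_lt_le hw he.le hs' herr ht).trans ?_
    gcongr
    refine le_mul_of_one_le_left (by positivity) (one_le_mul_of_one_le_of_one_le ?_ ?_)
    · exact Real.one_le_rpow (one_le_mul_of_one_le_of_one_le hM' hM) he.le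
    · linarith [Real.rpow_nonneg hN (min p q)]
  refine h1.trans ((add_le_add hsum hbad).trans ?_)
  have hθ : 0 ≤ q / |q - p| := by positivity
  rw [← add_mul, ← ENNReal.ofReal_add (by positivity) hD0]
  gcongr ENNReal.ofReal ?_ * volume Ω
  -- The balls contribute `2 + q / |q - p|` and the untouched pieces 1.
  calc (2 + q / |q - p|) * D + D = (3 + q / |q - p|) * D := by ring
    _ ≤ (4 * (1 + q / |q - p|)) * D := by
      gcongr
      linarith
    _ = _ := by rw [hD]; ring

end IsBallDecomposition

theorem ReductionBound.trans {K K' K'' : Set (Mat d m)} {p q M' M'' : ℝ} (hp : 1 ≤ p) (hq : 1 < q)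
    (hpq : p ≠ q) (hM' : 1 ≤ M') (hM'' : 1 ≤ M'') (h₁ : ReductionBound K K' p (M' ^ p))
    (h₂ : ReductionBound K' K'' q (M'' ^ q)) :
    ReductionBound K K'' (min p q) (4 * (1 + q / |q - p|) * (M' * M'') ^ (min p q)) := by
  intro A hA b ε α s hε hε1 hα hα1 hs Ω hΩ
  -- The exponent must reach `s` for the error integral and `min p q` for Chebyshev's inequality on
  -- the untouched pieces; each stage gets half of `ε`.
  obtain ⟨u, G, hpa, hw, ⟨H, hH⟩, hbd, herr, hdist⟩ := h₁ A hA b (ε / 2) α (max s (min p q))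
    (half_pos hε) (by linarith) hα hα1 (lt_max_of_lt_left hs) Ω hΩ
  have hpatch : ∀ B ∈ K', ∃ R : ℝ, 0 < R ∧ ∀ (c : E m) (r : ℝ), 0 < r → r < R →
      ∃ (W : E m → E d) (g : E m → Mat d m),
        IsPatch K'' B q (M'' ^ q) (ε / 2) s α 1 1 c r W g :=
    fun B hB => h₂.exists_isPatch hB (half_pos hε) (by linarith) hα hα1 hs
  choose! R hR hRp using hpatch
  obtain ⟨ι, _, c, r, B, Q, hdec, hrR⟩ := hpa.exists_isBallDecomposition K' R hR
  choose W g hWg using fun k => hRp (B k) (hdec.mem k) (c k) (r k) (hdec.radius_pos k) (hrR k)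
  refine ⟨fun x => u x + ∑' k, W k x, fun x => G x + Matrix.of fun i j => ∑' k, g k x i j,
    hdec.isPiecewiseAffine_add_tsum (fun k => (hWg k).eq_zero) fun k => (hWg k).piecewise,
    hw.add ((hdec.isW11WithGradient_tsum hΩ hw hq hM'' hWg).mono (subset_univ _)),
    ⟨_, hH.add ((hdec.holderWith_tsum (fun k => (hWg k).holder)
      fun k => (hWg k).eq_zero).holderOnWith _)⟩, fun x hx => ?_, ?_, fun t ht => ?_⟩
  · have hxΩ : x ∉ Ω := by
      rw [hΩ.isOpen.frontier_eq] at hx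
      exact hx.2
    have h0 : ∀ k, W k x = 0 := fun k => (hWg k).eq_zero x fun h => hxΩ (hdec.ball_subset k h)
    simp only [h0, tsum_zero, add_zero]
    exact hbd hx
  · have := hdec.error_lt hΩ hw (half_pos hε).le (half_pos hε).le (le_max_left _ _) hWg herr
    rwa [add_halves] at this
  · refine hdec.volume_lt_matNorm_le hΩ hw hp hq hpq hM' hM'' (matNorm_nonneg A) hWg
      (le_max_right _ _) (herr.le.trans ?_) hdist ht
    refine mul_le_of_le_one_left' ?_
    rw [ENNReal.ofReal_le_one]
    linarith

end WeakReduction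

theorem theorem4p3 {d m : ℕ} (K K' K'' : Set (WeakReduction.Mat d m)) (p q : ℝ)
    (hp : 1 ≤ p) (hq : 1 < q) (hpq : p ≠ q)
    (h₁ : WeakReduction.CanBeReduced K K' p) (h₂ : WeakReduction.CanBeReduced K' K'' q) :
    WeakReduction.CanBeReduced K K'' (min p q) ∧
    ∀ M' M'' : ℝ, 1 ≤ M' → 1 ≤ M'' →
      WeakReduction.ReductionBound K K' p (M' ^ p) →
      WeakReduction.ReductionBound K' K'' q (M'' ^ q) →
      WeakReduction.ReductionBound K K'' (min p q)
        (4 * (1 + q / |q - p|) * (M' * M'') ^ (min p q)) := by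
  refine ⟨?_, fun M' M'' hM' hM'' h h' => h.trans hp hq hpq hM' hM'' h'⟩
  obtain ⟨M', hM', h⟩ := h₁
  obtain ⟨M'', hM'', h'⟩ := h₂
  have hr : 0 < min p q := lt_min (one_pos.trans_le hp) (one_pos.trans hq)
  have hθ : 0 ≤ q / |q - p| := div_nonneg (one_pos.trans hq).le (abs_nonneg _)
  have hC : 1 ≤ 4 * (1 + q / |q - p|) * (M' * M'') ^ (min p q) :=
    one_le_mul_of_one_le_of_one_le (by linarith)
      (Real.one_le_rpow (one_le_mul_of_one_le_of_one_le hM' hM'') hr.le)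
  -- The `min p q`-th root of the explicit coefficient, which is at least 1 because the coefficient
  -- is.
  refine ⟨(4 * (1 + q / |q - p|) * (M' * M'') ^ (min p q)) ^ (1 / min p q),
    Real.one_le_rpow hC (by positivity), ?_⟩
  rw [← Real.rpow_mul (zero_le_one.trans hC), one_div_mul_cancel hr.ne', Real.rpow_one]
  exact h.trans hp hq hpq hM' hM'' h'
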